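/- Let $T>0$ and, for each $\varepsilon>0$, let $\theta_\varepsilon=(\theta_\varepsilon(s))_{s\in[0,T]}$ be a family of real functions on a probability space such that almost surely $\theta_\varepsilon\in L^2([0,T])$, and let $\eta_\varepsilon(t)=\int_0^t\theta_\varepsilon(s)\,ds$ be the corresponding process, whose paths lie in the Cameron–Martin space. Assume that, as $\varepsilon\to0$, the finite-dimensional distributions of $(\eta_\varepsilon(t))_{t\in[0,T]}$ converge in law to those of a standard Brownian motion $W$. For $n\ge1$, $f\in L^2([0,T]^n)$ and $t\in[0,T]$ put $$Y^f_{\eta_\varepsilon}(t)=\int_{[0,t]^n}f(x_1,\dots,x_n)\prod_{i=1}^n\theta_\varepsilon(x_i)\prod_{\substack{i,j=1\\ i\ne j}}^n\mathbf 1_{\{|x_i-x_j|>\varepsilon\}}\,dx_1\cdots dx_n .$$ Let $I_n$ denote the multiple Wiener–Itô integral of order $n$ with respect to $W$: for $f=\sum_k\alpha_k\mathbf 1_{\Delta_k}$ (a finite sum) with $\Delta_k=(a_k^1,b_k^1]\times\cdots\times(a_k^n,b_k^n]\subset[0,T]^n$ and $[a_k^h,b_k^h]\cap[a_k^l,b_k^l]=\emptyset$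 for $h\ne l$ it is $I_n(f)=\sum_k\alpha_k\prod_{i=1}^n\bigl(W(b_k^i)-W(a_k^i)\bigr)$, and for general $f\in L^2([0,T]^n)$ it is the $L^2$-limit of $I_n(f_m)$ for such simple functions $f_m\to f$ in $L^2([0,T]^n)$. Let $d,n_1,\dots,n_d\ge1$ be integers and let $f_k\in L^2([0,T]^{n_k})$ for $k=1,\dots,d$. Assume that for each $k$ there is a constant $C_k>0$ such that $$\sup_{\varepsilon>0,\ t\in[0,T]}E\bigl|Y^f_{\eta_\varepsilon}(t)\bigr|\le C_k\|f\|_{L^2([0,T]^{n_k})}\qquad\text{for all } f\in L^2([0,T]^{n_k}).$$ Then the integrals $I_{n_k}(f_k\mathbf 1_{[0,t]^{n_k}})$, $t\in[0,T]$, $k=1,\dots,d$, exist, and, as $\varepsilon\to0$, the finite-dimensional distributions of the $\mathbb R^d$-valued process $\bigl(Y^{f_1}_{\eta_\varepsilon}(t),\dots,Y^{f_d}_{\eta_\varepsilon}(t)\bigr)_{t\in[0,T]}$ converge in law to those of $\bigl(I_{n_1}(f_1\mathbf 1_{[0,t]^{n_1}}),\dots,I_{n_d}(f_d\mathbf 1_{[0,t]^{n_d}})\bigr)_{t\in[0,T]}$.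 -/

import Mathlib

open MeasureTheory ProbabilityTheory Filter Set
open scoped Topology NNReal ENNReal

noncomputable section

/-- The cube `[0,t]^n`. -/
def cube (n : ℕ) (t : ℝ) : Set (Fin n → ℝ) := Set.univ.pi fun _ => Set.Icc 0 t

/-- Lebesgue measure on the cube `[0,T]^n`, so that `L²([0,T]^n)` consists of the functions `f`
with `MemLp f 2 (cubeMeasure n T)`. -/
def cubeMeasure (n : ℕ) (T : ℝ) : Measure (Fin n → ℝ) := volume.restrict (cube n T)

/-! ### The multiple Wiener-Itô integral -/

/-- A box `(a₁,b₁] × ⋯ × (aₙ,bₙ]` in `[0,T]^n` with `[aᵢ,bᵢ] ∩ [aⱼ,bⱼ] = ∅` for `i ≠ j`. -/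
structure OffDiagBox (n : ℕ) (T : ℝ) where
  a : Fin n → ℝ
  b : Fin n → ℝ
  zero_le : ∀ i, 0 ≤ a i
  le : ∀ i, a i ≤ b i
  le_T : ∀ i, b i ≤ T
  disj : ∀ i j, i ≠ j → Disjoint (Set.Icc (a i) (b i)) (Set.Icc (a j) (b j))

/-- The set of points of a box. -/
def OffDiagBox.toSet {n : ℕ} {T : ℝ} (Δ : OffDiagBox n T) : Set (Fin n → ℝ) :=
  Set.univ.pi fun i => Set.Ioc (Δ.a i) (Δ.b i)

/-- The simple function `∑ₖ αₖ 1_{Δₖ}` given by a formal linear combination of boxes. -/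
def simpleFun {n : ℕ} {T : ℝ} (s : OffDiagBox n T →₀ ℝ) (x : Fin n → ℝ) : ℝ :=
  s.sum fun Δ α => α * Δ.toSet.indicator (fun _ => (1 : ℝ)) x

/-- The multiple Wiener-Itô integral `∑ₖ αₖ ∏ᵢ (W(bₖⁱ) - W(aₖⁱ))` of a simple function. -/
def simpleIntegral {Ω : Type*} (W : ℝ≥0 → Ω → ℝ) {n : ℕ} {T : ℝ}
    (s : OffDiagBox n T →₀ ℝ) (ω : Ω) : ℝ :=
  s.sum fun Δ α => α * ∏ i, (W (Δ.b i).toNNReal ω - W (Δ.a i).toNNReal ω)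

/-- `X` is (a version of) the multiple Wiener-Itô integral `I_n(f)` of `f ∈ L²([0,T]^n)` with
respect to `W`: it is the limit in `L²(P)` of the integrals of simple functions that vanish near
the diagonals and converge to `f` in `L²([0,T]^n)`. -/
def IsMultipleWienerIntegral {Ω : Type*} [MeasurableSpace Ω] (W : ℝ≥0 → Ω → ℝ) (P : Measure Ω)
    {n : ℕ} (T : ℝ) (f : (Fin n → ℝ) → ℝ) (X : Ω → ℝ) : Prop :=
  MemLp X 2 P ∧ ∃ s : ℕ → (OffDiagBox n T →₀ ℝ),
    Tendsto (fun m => eLpNorm (fun x => f x - simpleFun (s m) x) 2 (cubeMeasure n T))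
      atTop (𝓝 0) ∧
    Tendsto (fun m => eLpNorm (fun ω => X ω - simpleIntegral W (s m) ω) 2 P) atTop (𝓝 0)

open Classical in
/-- The multiple Wiener-Itô integral `I_n(f)` with respect to `W` (a chosen version). -/
def multipleWienerIntegral {Ω : Type*} [MeasurableSpace Ω] (W : ℝ≥0 → Ω → ℝ) (P : Measure Ω)
    {n : ℕ} (T : ℝ) (f : (Fin n → ℝ) → ℝ) : Ω → ℝ :=
  if h : ∃ X : Ω → ℝ, IsMultipleWienerIntegral W P T f X then h.choose else 0

/-! ### The approximating processes -/

/-- The process `η(t) = ∫₀ᵗ θ(s) ds`. -/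
def etaProcess {Ω : Type*} (θ : ℝ → Ω → ℝ) (t : ℝ) (ω : Ω) : ℝ := ∫ s in (0 : ℝ)..t, θ s ω

/-- The process `Y^f_η(t) = ∫_{[0,t]^n} f(x) ∏ᵢ θ(xᵢ) ∏_{i ≠ j} 1_{|xᵢ - xⱼ| > ε} dx`,
for `η = ∫ θ`. -/
def offDiagIntegral {Ω : Type*} {n : ℕ} (ε : ℝ) (θ : ℝ → Ω → ℝ) (f : (Fin n → ℝ) → ℝ)
    (t : ℝ) (ω : Ω) : ℝ :=
  ∫ x in cube n t, f x * (∏ i, θ (x i) ω) *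
    ∏ p ∈ (Finset.univ : Finset (Fin n)).offDiag, if ε < |x p.1 - x p.2| then (1 : ℝ) else 0

/-- The uniform bound `sup_{ε > 0, t ∈ [0,T]} E|Y^f_{η_ε}(t)| ≤ C ‖f‖_{L²([0,T]^n)}` for all
`f ∈ L²([0,T]^n)`, for one order `n`, with one constant `C`. -/
def UniformBound {Ω : Set.Ioi (0 : ℝ) → Type*} [∀ ε, MeasurableSpace (Ω ε)]
    (P : ∀ ε, Measure (Ω ε)) (θ : ∀ ε, ℝ → Ω ε → ℝ) (T : ℝ) (n : ℕ) : Prop :=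
  ∃ C : ℝ, 0 < C ∧ ∀ f : (Fin n → ℝ) → ℝ, MemLp f 2 (cubeMeasure n T) →
    ∀ ε : Set.Ioi (0 : ℝ), ∀ t ∈ Set.Icc 0 T,
      ∫⁻ ω, ‖offDiagIntegral (ε : ℝ) (θ ε) f t ω‖ₑ ∂(P ε) ≤
        ENNReal.ofReal C * eLpNorm f 2 (cubeMeasure n T)

/-- Convergence in law, as `ε → 0`, of the finite dimensional distributions of the processes
`X ε`, indexed by `[0,T]`, to those of the process `Z`. -/
def TendstoFDD {E : Type*} [TopologicalSpace E] [SecondCountableTopology E] [MeasurableSpace E]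
    [BorelSpace E] {Ω : Set.Ioi (0 : ℝ) → Type*} [∀ ε, MeasurableSpace (Ω ε)]
    {Ω' : Type*} [MeasurableSpace Ω'] (T : ℝ)
    (X : ∀ ε, ℝ → Ω ε → E) (Z : ℝ → Ω' → E)
    (P : ∀ ε, Measure (Ω ε)) [∀ ε, IsProbabilityMeasure (P ε)]
    (P' : Measure Ω') [IsProbabilityMeasure P'] : Prop :=
  ∀ (r : ℕ) (t : Fin r → ℝ), (∀ j, t j ∈ Set.Icc 0 T) →
    TendstoInDistribution (fun ε ω j => X ε (t j) ω)
      (comap (Subtype.val : Set.Ioi (0 : ℝ) → ℝ) (𝓝[>] 0))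
      (fun ω j => Z (t j) ω) P P'

end

/-! Convergence is transparent for simple functions and reaches general integrands by an
approximation that is uniform in `ε`.

The sides of an off-diagonal box are disjoint compact intervals, hence at positive distance. For `ε`
below these distances the kernel equals `1` on the box, and by Fubini the approximating integral of
a simple function is a polynomial in finitely many increments of `η_ε`. The continuous mapping
theorem gives joint convergence in law to the same polynomial in the increments of `W`, which is the
simple Wiener integral (`TendstoFDD.tendstoInDistribution_incrementSum`).

For general `f`, the time `t` is absorbed into the integrand `f 1_{[0,t]^n}`, which is approximated
in `L²` by simple functions. The assumed bound controls the error before the limit in `L¹`,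
uniformly in `ε`; the definition of `I_n` controls it in the limit.
`tendstoInDistribution_of_approx` combines the three estimates.

Existence of `I_n` needs two more facts: simple functions vanishing near the diagonals are dense in
`L²`, since the diagonals are null (`exists_eLpNorm_sub_simpleFun_le`), and `E[I_n(s)²] ≤ n^n ‖s‖²`
for simple `s` (`IsBrownianReal.integral_simpleIntegral_sq_le`). -/

/-! ### Simple functions and expansion along a common grid -/

theorem simpleFun_sub {n : ℕ} {T : ℝ} (s t : OffDiagBox n T →₀ ℝ) (x : Fin n → ℝ) :
    simpleFun (s - t) x = simpleFun s x - simpleFun t x :=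
  Finsupp.sum_sub_index fun _ _ _ => sub_mul _ _ _

theorem simpleIntegral_sub {Ω : Type*} (W : ℝ≥0 → Ω → ℝ) {n : ℕ} {T : ℝ}
    (s t : OffDiagBox n T →₀ ℝ) (ω : Ω) :
    simpleIntegral W (s - t) ω = simpleIntegral W s ω - simpleIntegral W t ω :=
  Finsupp.sum_sub_index fun _ _ _ => sub_mul _ _ _

theorem simpleFun_sum_single {n : ℕ} {T : ℝ} {ι : Type*} (A : Finset ι) (Δ : ι → OffDiagBox n T)
    (c : ι → ℝ) (x : Fin n → ℝ) :
    simpleFun (∑ i ∈ A, Finsupp.single (Δ i) (c i)) x =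
      ∑ i ∈ A, c i * (Δ i).toSet.indicator (fun _ => (1 : ℝ)) x := by
  unfold simpleFun
  rw [← Finsupp.sum_finsetSum_index (by simp) (by intros; ring)]
  refine Finset.sum_congr rfl fun i _ => ?_
  rw [Finsupp.sum_single_index (by simp)]

theorem OffDiagBox.measurableSet_toSet {n : ℕ} {T : ℝ} (Δ : OffDiagBox n T) :
    MeasurableSet Δ.toSet :=
  MeasurableSet.univ_pi fun _ => measurableSet_Ioc

/-- In this form the indicator is a product of increments of `u ↦ 1_{x i ≤ u}`, so one grid
expansion serves both a simple function and its integral. -/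
theorem OffDiagBox.indicator_eq_prod {n : ℕ} {T : ℝ} (Δ : OffDiagBox n T) (x : Fin n → ℝ) :
    Δ.toSet.indicator (fun _ => (1 : ℝ)) x =
      ∏ i, ((Set.Ici (x i)).indicator (fun _ => (1 : ℝ)) (Δ.b i) -
        (Set.Ici (x i)).indicator (fun _ => (1 : ℝ)) (Δ.a i)) := by
  classical
  have key : ∀ i, ((Set.Ici (x i)).indicator (fun _ => (1 : ℝ)) (Δ.b i) -
        (Set.Ici (x i)).indicator (fun _ => (1 : ℝ)) (Δ.a i)) =
        if x i ∈ Set.Ioc (Δ.a i) (Δ.b i) then 1 else 0 := by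
    intro i
    have := Δ.le i
    simp only [Set.indicator_apply, Set.mem_Ici, Set.mem_Ioc]
    by_cases h1 : x i ≤ Δ.a i
    · simp [h1, h1.trans this, not_lt.2 h1]
    · by_cases h2 : x i ≤ Δ.b i <;> simp [h1, h2, not_le.1 h1]
  rw [Finset.prod_congr rfl fun i _ => key i, Finset.prod_ite_zero]
  simp [Set.indicator_apply, OffDiagBox.toSet]

/-- A finite set of points of `[0,T]` is enumerated by a monotone sequence in `[0,T]`. -/
theorem exists_monotone_grid {T : ℝ} (hT : 0 ≤ T) (S : Finset ℝ) (hS : ∀ x ∈ S, x ∈ Set.Icc 0 T) :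
    ∃ (τ : ℕ → ℝ) (idx : ℝ → ℕ) (N : ℕ), Monotone τ ∧ (∀ k, τ k ∈ Set.Icc 0 T) ∧
      (∀ x ∈ S, τ (idx x) = x ∧ idx x ≤ N) ∧ ∀ x ∈ S, ∀ y ∈ S, x ≤ y → idx x ≤ idx y := by
  classical
  -- Adjoining `0` makes the set nonempty, so its cardinality has the form `N + 1`.
  obtain ⟨N, hN⟩ : ∃ N, (insert 0 S).card = N + 1 :=
    ⟨(insert 0 S).card - 1, by have : 0 < (insert (0 : ℝ) S).card := Finset.card_pos.2 (by simp)
                               omega⟩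
  set e := (insert 0 S).orderEmbOfFin hN with he
  let τ : ℕ → ℝ := fun k => e ⟨min k N, by omega⟩
  have hmono : Monotone τ := fun i j hij => e.monotone (by
    simp only [Fin.mk_le_mk]; omega)
  have hmem : ∀ k, τ k ∈ Set.Icc 0 T := by
    intro k
    have : τ k ∈ insert 0 S := Finset.orderEmbOfFin_mem _ hN _
    rcases Finset.mem_insert.1 this with h | h
    · rw [h]; exact ⟨le_rfl, hT⟩
    · exact hS _ h
  have hex : ∀ x, ∃ k, x ∈ S → τ k = x ∧ k ≤ N := by
    intro x
    by_cases hx : x ∈ S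
    · have : x ∈ Set.range e := by
        rw [he, Finset.range_orderEmbOfFin]
        simp [hx]
      obtain ⟨k, hk⟩ := this
      refine ⟨k, fun _ => ⟨?_, by omega⟩⟩
      rw [← hk]
      simp only [τ]
      congr 1
      ext
      simp; omega
    · exact ⟨0, fun h => absurd h hx⟩
  choose idx hidx using hex
  refine ⟨τ, idx, N, hmono, hmem, hidx, fun x hx y hy hxy => ?_⟩
  rcases hxy.eq_or_lt with rfl | h
  · rfl
  · by_contra hlt
    have := hmono (not_le.1 hlt).le
    rw [(hidx x hx).1, (hidx y hy).1] at this
    exact absurd this (not_le.2 h)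

/-- Expansion of a linear combination of products of increments along a common grid. The
coefficients do not depend on the functions `g i`, and vanish unless the intervals are distinct. -/
theorem exists_grid_expansion {n : ℕ} {T : ℝ} (hT : 0 ≤ T) (s : OffDiagBox n T →₀ ℝ) :
    ∃ (τ : ℕ → ℝ) (N : ℕ) (c : (Fin n → ℕ) → ℝ), Monotone τ ∧ (∀ k, τ k ∈ Set.Icc 0 T) ∧
      (∀ φ, c φ ≠ 0 → Function.Injective φ) ∧
      ∀ g : Fin n → ℝ → ℝ, (s.sum fun Δ α => α * ∏ i, (g i (Δ.b i) - g i (Δ.a i))) =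
        ∑ φ ∈ Fintype.piFinset fun _ : Fin n => Finset.range N,
          c φ * ∏ i, (g i (τ (φ i + 1)) - g i (τ (φ i))) := by
  classical
  let S : Finset ℝ := s.support.biUnion fun Δ => Finset.univ.image Δ.a ∪ Finset.univ.image Δ.b
  have hSa : ∀ Δ ∈ s.support, ∀ i, Δ.a i ∈ S := fun Δ hΔ i =>
    Finset.mem_biUnion.2 ⟨Δ, hΔ, by simp⟩
  have hSb : ∀ Δ ∈ s.support, ∀ i, Δ.b i ∈ S := fun Δ hΔ i =>
    Finset.mem_biUnion.2 ⟨Δ, hΔ, by simp⟩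
  have hS : ∀ x ∈ S, x ∈ Set.Icc 0 T := by
    intro x hx
    obtain ⟨Δ, -, h⟩ := Finset.mem_biUnion.1 hx
    simp only [Finset.mem_union, Finset.mem_image, Finset.mem_univ, true_and] at h
    rcases h with ⟨i, rfl⟩ | ⟨i, rfl⟩
    · exact ⟨Δ.zero_le i, (Δ.le i).trans (Δ.le_T i)⟩
    · exact ⟨(Δ.zero_le i).trans (Δ.le i), Δ.le_T i⟩
  obtain ⟨τ, idx, N, hmono, hmem, hidx, hidxm⟩ := exists_monotone_grid hT S hS
  let A : OffDiagBox n T → Finset (Fin n → ℕ) := fun Δ =>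
    Fintype.piFinset fun i => Finset.Ico (idx (Δ.a i)) (idx (Δ.b i))
  let c : (Fin n → ℕ) → ℝ := fun φ => ∑ Δ ∈ s.support, if φ ∈ A Δ then s Δ else 0
  refine ⟨τ, N, c, hmono, hmem, ?_, ?_⟩
  · intro φ hφ
    obtain ⟨Δ, hΔ, h⟩ := Finset.exists_ne_zero_of_sum_ne_zero hφ
    have hφA : φ ∈ A Δ := by
      by_contra h'
      simp [h'] at h
    have hI : ∀ i, τ (φ i) ∈ Set.Icc (Δ.a i) (Δ.b i) := by
      intro i
      have := Finset.mem_Ico.1 (Fintype.mem_piFinset.1 hφA i)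
      rw [← (hidx _ (hSa Δ hΔ i)).1, ← (hidx _ (hSb Δ hΔ i)).1]
      exact ⟨hmono this.1, hmono this.2.le⟩
    -- If `φ i = φ j`, the grid point `τ (φ i)` lies in both closed sides `i` and `j`, which are
    -- disjoint unless `i = j`.
    intro i j hij
    by_contra hne
    refine Set.disjoint_left.1 (Δ.disj i j hne) (hI i) ?_
    rw [hij]
    exact hI j
  · intro g
    have h1 : ∀ Δ ∈ s.support, ∏ i, (g i (Δ.b i) - g i (Δ.a i)) =
        ∑ φ ∈ Fintype.piFinset fun _ : Fin n => Finset.range N,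
          if φ ∈ A Δ then ∏ i, (g i (τ (φ i + 1)) - g i (τ (φ i))) else 0 := by
      intro Δ hΔ
      rw [← Finset.sum_filter, Finset.filter_mem_eq_inter, Finset.inter_eq_right.2, ]
      -- Each increment telescopes over the grid steps between its endpoints; expanding the product
      -- of these sums yields the sum over `A Δ`.
      · rw [← Finset.prod_univ_sum (fun i => Finset.Ico (idx (Δ.a i)) (idx (Δ.b i)))
          fun i k => g i (τ (k + 1)) - g i (τ k)]
        refine Finset.prod_congr rfl fun i _ => ?_
        rw [Finset.sum_Ico_eq_sub _ (hidxm _ (hSa Δ hΔ i) _ (hSb Δ hΔ i) (Δ.le i)),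
          Finset.sum_range_sub (fun k => g i (τ k)), Finset.sum_range_sub (fun k => g i (τ k)),
          (hidx _ (hSa Δ hΔ i)).1, (hidx _ (hSb Δ hΔ i)).1]
        ring
      · intro φ hφ
        rw [Fintype.mem_piFinset] at hφ ⊢
        intro i
        have := Finset.mem_Ico.1 (hφ i)
        have h2 := (hidx _ (hSb Δ hΔ i)).2
        exact Finset.mem_range.2 (by omega)
    unfold Finsupp.sum
    rw [Finset.sum_congr rfl fun Δ hΔ => congrArg (s Δ * ·) (h1 Δ hΔ)]
    simp only [c, Finset.sum_mul, Finset.mul_sum]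
    rw [Finset.sum_comm]
    refine Finset.sum_congr rfl fun φ _ => Finset.sum_congr rfl fun Δ _ => ?_
    split_ifs <;> simp

/-! ### Second moment of simple integrals -/

/-- An index in only one of the two sets contributes an independent centred factor, which kills the
expectation; if there is none, the squares factorize. -/
theorem integral_prod_mul_prod_of_iIndepFun {Ω : Type*} [MeasurableSpace Ω] {P : Measure Ω}
    {ξ : ℕ → Ω → ℝ} (hind : iIndepFun ξ P) (hm : ∀ k, AEMeasurable (ξ k) P)
    (h0 : ∀ k, ∫ ω, ξ k ω ∂P = 0) (A B : Finset ℕ) :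
    ∫ ω, (∏ k ∈ A, ξ k ω) * ∏ k ∈ B, ξ k ω ∂P =
      if A = B then ∏ k ∈ A, ∫ ω, ξ k ω ^ 2 ∂P else 0 := by
  classical
  have := hind.isProbabilityMeasure
  have h1 : ∀ ω, (∏ k ∈ A, ξ k ω) * ∏ k ∈ B, ξ k ω =
      ∏ k : ↥(A ∪ B), (fun x : ℝ => (if (k : ℕ) ∈ A then x else 1) *
        (if (k : ℕ) ∈ B then x else 1)) (ξ k ω) := by
    intro ω
    rw [Finset.prod_coe_sort (A ∪ B) (fun k => (if k ∈ A then ξ k ω else 1) *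
        (if k ∈ B then ξ k ω else 1)), Finset.prod_mul_distrib]
    congr 1
    · rw [← Finset.prod_filter, Finset.filter_mem_eq_inter, Finset.union_inter_cancel_left]
    · rw [← Finset.prod_filter, Finset.filter_mem_eq_inter, Finset.union_inter_cancel_right]
  simp_rw [h1]
  have h2 : iIndepFun (fun k : ↥(A ∪ B) => ξ k) P := hind.precomp Subtype.val_injective
  rw [h2.integral_fun_prod_comp (fun k => hm k) (f := fun (k : ↥(A ∪ B)) (x : ℝ) =>
    (if (k : ℕ) ∈ A then x else 1) * (if (k : ℕ) ∈ B then x else 1))]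
  · rw [Finset.prod_coe_sort (A ∪ B) (fun k => ∫ ω, (if k ∈ A then ξ k ω else 1) *
        (if k ∈ B then ξ k ω else 1) ∂P)]
    split_ifs with hAB
    · subst hAB
      rw [Finset.union_self]
      refine Finset.prod_congr rfl fun k hk => ?_
      simp [hk, sq]
    · obtain ⟨k, hk, hk'⟩ : ∃ k ∈ A ∪ B, ¬ (k ∈ A ∧ k ∈ B) := by
        by_contra! h
        refine hAB (Finset.ext fun k => ⟨fun hk => (h k ?_).2, fun hk => (h k ?_).1⟩) <;>
          simp [hk]
      refine Finset.prod_eq_zero hk ?_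
      rcases Finset.mem_union.1 hk with h | h
      · have : k ∉ B := fun h' => hk' ⟨h, h'⟩
        simp [h, this, h0]
      · have : k ∉ A := fun h' => hk' ⟨h', h⟩
        simp [h, this, h0]
  · intro k
    refine Measurable.aestronglyMeasurable ?_
    split_ifs <;> fun_prop

/-- A `ψ` with the same image as `φ` takes its values in a set of at most `n` elements, so there are
at most `n ^ n` of them; the cross terms are split by `2ab ≤ a² + b²`. -/
theorem sum_sum_mul_le_of_image_eq {n : ℕ} (F : Finset (Fin n → ℕ)) (c : (Fin n → ℕ) → ℝ)
    (w : Finset ℕ → ℝ) (hw : ∀ A, 0 ≤ w A) :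
    ∑ φ ∈ F, ∑ ψ ∈ F, c φ * c ψ * (if Finset.univ.image φ = Finset.univ.image ψ then
        w (Finset.univ.image φ) else 0) ≤
      (n : ℝ) ^ n * ∑ φ ∈ F, c φ ^ 2 * w (Finset.univ.image φ) := by
  classical
  let M : (Fin n → ℕ) → (Fin n → ℕ) → ℝ := fun φ ψ =>
    if Finset.univ.image φ = Finset.univ.image ψ then w (Finset.univ.image φ) else 0
  have hM0 : ∀ φ ψ, 0 ≤ M φ ψ := fun φ ψ => by
    simp only [M]; split_ifs; exacts [hw _, le_rfl]
  have hMs : ∀ φ ψ, M φ ψ = M ψ φ := fun φ ψ => by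
    simp only [M]
    by_cases h : Finset.univ.image φ = Finset.univ.image ψ
    · simp [h]
    · simp [h, Ne.symm h]
  have hcount : ∀ φ ∈ F, ∑ ψ ∈ F, M φ ψ ≤ (n : ℝ) ^ n * w (Finset.univ.image φ) := by
    intro φ _
    simp only [M]
    rw [← Finset.sum_filter, Finset.sum_const, nsmul_eq_mul]
    refine mul_le_mul_of_nonneg_right ?_ (hw _)
    have hsub : F.filter (fun ψ => Finset.univ.image φ = Finset.univ.image ψ) ⊆
        Fintype.piFinset fun _ : Fin n => Finset.univ.image φ := by
      intro ψ hψ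
      rw [Fintype.mem_piFinset]
      intro i
      rw [(Finset.mem_filter.1 hψ).2]
      exact Finset.mem_image_of_mem _ (Finset.mem_univ _)
    have h1 := Finset.card_le_card hsub
    rw [Fintype.card_piFinset, Finset.prod_const, Finset.card_univ, Fintype.card_fin] at h1
    have h2 : (Finset.univ.image φ).card ≤ n := by
      simpa using (Finset.card_image_le : (Finset.univ.image φ).card ≤ _)
    exact_mod_cast h1.trans (Nat.pow_le_pow_left h2 n)
  have hle : ∀ φ ψ, c φ * c ψ * M φ ψ ≤ c φ ^ 2 / 2 * M φ ψ + c ψ ^ 2 / 2 * M ψ φ := by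
    intro φ ψ
    rw [hMs ψ φ, ← add_mul]
    exact mul_le_mul_of_nonneg_right (by nlinarith [sq_nonneg (c φ - c ψ)]) (hM0 _ _)
  calc _ ≤ ∑ φ ∈ F, ∑ ψ ∈ F, (c φ ^ 2 / 2 * M φ ψ + c ψ ^ 2 / 2 * M ψ φ) :=
        Finset.sum_le_sum fun φ _ => Finset.sum_le_sum fun ψ _ => hle φ ψ
    _ = ∑ φ ∈ F, c φ ^ 2 * ∑ ψ ∈ F, M φ ψ := by
        simp only [Finset.sum_add_distrib]
        rw [Finset.sum_comm (f := fun φ ψ => c ψ ^ 2 / 2 * M ψ φ), ← Finset.sum_add_distrib]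
        refine Finset.sum_congr rfl fun φ _ => ?_
        rw [← Finset.mul_sum]
        ring
    _ ≤ ∑ φ ∈ F, c φ ^ 2 * ((n : ℝ) ^ n * w (Finset.univ.image φ)) :=
        Finset.sum_le_sum fun φ hφ => mul_le_mul_of_nonneg_left (hcount φ hφ) (sq_nonneg _)
    _ = _ := by
        rw [Finset.mul_sum]
        exact Finset.sum_congr rfl fun φ _ => by ring

instance isFiniteMeasure_cubeMeasure (n : ℕ) (T : ℝ) : IsFiniteMeasure (cubeMeasure n T) :=
  ⟨by
    rw [cubeMeasure, Measure.restrict_apply_univ]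
    exact (isCompact_univ_pi fun _ => isCompact_Icc).measure_lt_top⟩

theorem measurableSet_cube (n : ℕ) (t : ℝ) : MeasurableSet (cube n t) :=
  MeasurableSet.univ_pi fun _ => measurableSet_Icc

theorem memLp_simpleFun {n : ℕ} {T : ℝ} (s : OffDiagBox n T →₀ ℝ) (p : ℝ≥0∞) :
    MemLp (simpleFun s) p (cubeMeasure n T) := by
  unfold simpleFun Finsupp.sum
  exact memLp_finsetSum _ fun Δ _ =>
    ((memLp_const (1 : ℝ)).indicator Δ.measurableSet_toSet).const_mul _

theorem eLpNorm_two_eq_ofReal_sqrt_integral_sq {α : Type*} [MeasurableSpace α] {μ : Measure α}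
    {f : α → ℝ} (hf : MemLp f 2 μ) : eLpNorm f 2 μ = ENNReal.ofReal (√(∫ x, f x ^ 2 ∂μ)) := by
  rw [hf.eLpNorm_eq_integral_rpow_norm (by norm_num) (by norm_num), Real.sqrt_eq_rpow]
  simp

/-- Hölder's inequality, with every factor in `L^p` for `p = 2 * A.card`. -/
theorem memLp_two_prod_of_forall {α ι : Type*} [MeasurableSpace α] {μ : Measure α}
    [IsFiniteMeasure μ] {f : ι → α → ℝ} (A : Finset ι)
    (hf : ∀ i ∈ A, ∀ p : ℝ≥0∞, p ≠ ∞ → MemLp (f i) p μ) :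
    MemLp (fun x => ∏ i ∈ A, f i x) 2 μ := by
  rcases A.eq_empty_or_nonempty with rfl | hA
  · simpa using memLp_const 1
  have h0 : (A.card : ℝ≥0∞) ≠ 0 := by exact_mod_cast hA.card_pos.ne'
  refine (MemLp.prod' (p := fun _ => 2 * A.card) fun i hi =>
    hf i hi _ (by finiteness)).mono_exponent ?_
  rw [Finset.sum_const, nsmul_eq_mul, ENNReal.mul_inv (Or.inl h0) (Or.inl (by simp)), inv_inv,
    mul_left_comm, ENNReal.inv_mul_cancel h0 (by simp), mul_one]

section Increments

variable {Ω : Type*} [MeasurableSpace Ω] {P : Measure Ω} {W : ℝ≥0 → Ω → ℝ}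

theorem ProbabilityTheory.IsBrownianReal.memLp_sub (hW : IsBrownianReal W P) (s t : ℝ≥0) {p : ℝ≥0∞} (hp : p ≠ ∞) :
    MemLp (fun ω => W s ω - W t ω) p P := by
  have h := hW.hasLaw_sub s t
  have := memLp_id_gaussianReal' (μ := 0) (v := nndist s.1 t.1) p hp
  rw [← h.map_eq] at this
  exact (memLp_map_measure_iff (by fun_prop) h.aemeasurable).1 this

theorem ProbabilityTheory.IsBrownianReal.integral_sub (hW : IsBrownianReal W P) (s t : ℝ≥0) :
    ∫ ω, (W s ω - W t ω) ∂P = 0 :=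
  (hW.hasLaw_sub s t).integral_eq.trans integral_id_gaussianReal

theorem ProbabilityTheory.IsBrownianReal.integral_sub_sq (hW : IsBrownianReal W P) {s t : ℝ≥0} (hst : s ≤ t) :
    ∫ ω, (W t ω - W s ω) ^ 2 ∂P = t - s := by
  have := hW.isGaussianProcess.isProbabilityMeasure
  have h := hW.hasLaw_sub t s
  have h1 : Var[fun ω => W t ω - W s ω; P] = ((nndist (t : ℝ) (s : ℝ) : ℝ≥0) : ℝ) :=
    h.variance_eq.trans variance_id_gaussianReal
  rw [variance_eq_sub (hW.memLp_sub t s (by norm_num)), hW.integral_sub t s] at h1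
  rw [zero_pow two_ne_zero, sub_zero] at h1
  refine h1.trans ?_
  rw [coe_nndist, Real.dist_eq]
  exact abs_of_nonneg (sub_nonneg.2 hst)

theorem ProbabilityTheory.IsBrownianReal.memLp_simpleIntegral (hW : IsBrownianReal W P) {n : ℕ} {T : ℝ}
    (s : OffDiagBox n T →₀ ℝ) : MemLp (simpleIntegral W s) 2 P := by
  have := hW.isGaussianProcess.isProbabilityMeasure
  unfold simpleIntegral Finsupp.sum
  refine memLp_finsetSum _ fun Δ _ => MemLp.const_mul ?_ _
  exact memLp_two_prod_of_forall _ fun i _ p hp => hW.memLp_sub _ _ hp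

end Increments

/-- Distinct cells of a grid are disjoint, so the square has no cross terms. Repeated grid points
only produce empty cells. -/
theorem sum_sq_le_integral_simpleFun_sq {n : ℕ} {T : ℝ} {τ : ℕ → ℝ} (hτ : Monotone τ)
    (hτT : ∀ k, τ k ∈ Set.Icc 0 T) (F : Finset (Fin n → ℕ)) (c : (Fin n → ℕ) → ℝ) :
    ∑ φ ∈ F, c φ ^ 2 * ∏ i, (τ (φ i + 1) - τ (φ i)) =
      ∫ x, (∑ φ ∈ F, c φ * (Set.univ.pi fun i => Set.Ioc (τ (φ i)) (τ (φ i + 1))).indicator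
        (fun _ => (1 : ℝ)) x) ^ 2 ∂cubeMeasure n T := by
  classical
  let B : (Fin n → ℕ) → Set (Fin n → ℝ) := fun φ =>
    Set.univ.pi fun i => Set.Ioc (τ (φ i)) (τ (φ i + 1))
  have hBm : ∀ φ, MeasurableSet (B φ) := fun φ => MeasurableSet.univ_pi fun _ => measurableSet_Ioc
  have hBT : ∀ φ, B φ ⊆ cube n T := fun φ =>
    Set.pi_mono fun i _ x hx => ⟨(hτT _).1.trans hx.1.le, hx.2.trans (hτT _).2⟩
  have hdisj : ∀ φ ψ, φ ≠ ψ → Disjoint (B φ) (B ψ) := by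
    intro φ ψ h
    refine Set.disjoint_left.2 fun x hx hx' => h (funext fun i => ?_)
    have h1 := hx i (Set.mem_univ _)
    have h2 := hx' i (Set.mem_univ _)
    by_contra hne
    rcases lt_or_gt_of_ne hne with hlt | hlt
    · exact absurd (h1.2.trans (hτ hlt)) (not_le.2 h2.1)
    · exact absurd (h2.2.trans (hτ hlt)) (not_le.2 h1.1)
  have hpt : ∀ x, (∑ φ ∈ F, c φ * (B φ).indicator (fun _ => (1 : ℝ)) x) ^ 2 =
      ∑ φ ∈ F, c φ ^ 2 * (B φ).indicator (fun _ => (1 : ℝ)) x := by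
    intro x
    rw [sq, Finset.sum_mul_sum]
    refine Finset.sum_congr rfl fun φ hφ => ?_
    rw [Finset.sum_eq_single φ]
    · by_cases hx : x ∈ B φ <;> simp [hx, sq]
    · intro ψ _ hne
      by_cases hx : x ∈ B φ
      · have := Set.disjoint_left.1 (hdisj φ ψ hne.symm) hx
        simp [this]
      · simp [hx]
    · exact fun h => absurd hφ h
  change _ = ∫ x, (∑ φ ∈ F, c φ * (B φ).indicator (fun _ => (1 : ℝ)) x) ^ 2 ∂cubeMeasure n T
  simp_rw [hpt]
  rw [integral_finsetSum]
  · refine Finset.sum_congr rfl fun φ _ => ?_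
    rw [integral_const_mul]
    congr 1
    rw [integral_indicator_const _ (hBm φ), smul_eq_mul, mul_one, cubeMeasure,
      measureReal_restrict_apply (hBm φ), Set.inter_eq_left.2 (hBT φ), measureReal_def,
      Real.volume_pi_Ioc_toReal (fun i => hτ (Nat.le_succ _))]
  · exact fun φ _ => ((integrable_const (1 : ℝ)).indicator (hBm φ)).const_mul _

/-- On a common grid the integral is a combination of products of distinct independent centred
increments. Two such products are orthogonal unless they use the same set of increments, so only
multi-indices with equal image interact, which costs the factor `n ^ n`. -/
theorem ProbabilityTheory.IsBrownianReal.integral_simpleIntegral_sq_le {Ω : Type*} [MeasurableSpace Ω]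
    {P : Measure Ω} {W : ℝ≥0 → Ω → ℝ} (hW : IsBrownianReal W P) {n : ℕ} {T : ℝ} (hT : 0 ≤ T)
    (s : OffDiagBox n T →₀ ℝ) :
    ∫ ω, simpleIntegral W s ω ^ 2 ∂P ≤
      (n : ℝ) ^ n * ∫ x, simpleFun s x ^ 2 ∂cubeMeasure n T := by
  classical
  have := hW.isGaussianProcess.isProbabilityMeasure
  obtain ⟨τ, N, c, hτ, hτT, hc, hexp⟩ := exists_grid_expansion hT s
  set F := Fintype.piFinset fun _ : Fin n => Finset.range N with hF
  let t : ℕ → ℝ≥0 := fun k => (τ k).toNNReal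
  have ht : Monotone t := fun i j h => Real.toNNReal_mono (hτ h)
  let ξ : ℕ → Ω → ℝ := fun k ω => W (t (k + 1)) ω - W (t k) ω
  let w : Finset ℕ → ℝ := fun A => ∏ k ∈ A, (τ (k + 1) - τ k)
  have hw : ∀ A, 0 ≤ w A := fun A =>
    Finset.prod_nonneg fun k _ => sub_nonneg.2 (hτ (Nat.le_succ k))
  -- The product over coordinates is a product over the image because `φ` is injective whenever `c φ
  -- ≠ 0`.
  have himage : ∀ (φ : Fin n → ℕ) (u : ℕ → ℝ),
      c φ * ∏ i, u (φ i) = c φ * ∏ k ∈ Finset.univ.image φ, u k := by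
    intro φ u
    by_cases h : c φ = 0
    · simp [h]
    · rw [Finset.prod_image fun i _ j _ hij => hc φ h hij]
  have hI : ∀ ω, simpleIntegral W s ω =
      ∑ φ ∈ F, c φ * ∏ k ∈ Finset.univ.image φ, ξ k ω := by
    intro ω
    rw [simpleIntegral, hexp fun _ u => W u.toNNReal ω]
    exact Finset.sum_congr rfl fun φ _ => himage φ fun k => ξ k ω
  have hS : ∀ x, simpleFun s x = ∑ φ ∈ F, c φ *
      (Set.univ.pi fun i => Set.Ioc (τ (φ i)) (τ (φ i + 1))).indicator (fun _ => (1 : ℝ)) x := by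
    intro x
    unfold simpleFun
    simp_rw [OffDiagBox.indicator_eq_prod]
    rw [hexp fun i => (Set.Ici (x i)).indicator fun _ => (1 : ℝ)]
    refine Finset.sum_congr rfl fun φ _ => ?_
    congr 1
    have key : ∀ i, ((Set.Ici (x i)).indicator (fun _ => (1 : ℝ)) (τ (φ i + 1)) -
        (Set.Ici (x i)).indicator (fun _ => (1 : ℝ)) (τ (φ i))) =
        if x i ∈ Set.Ioc (τ (φ i)) (τ (φ i + 1)) then 1 else 0 := by
      intro i
      have := hτ (Nat.le_succ (φ i))
      simp only [Set.indicator_apply, Set.mem_Ici, Set.mem_Ioc]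
      by_cases h1 : x i ≤ τ (φ i)
      · simp [h1, h1.trans this, not_lt.2 h1]
      · by_cases h2 : x i ≤ τ (φ i + 1) <;> simp [h1, h2, not_le.1 h1]
    rw [Finset.prod_congr rfl fun i _ => key i, Finset.prod_ite_zero]
    simp [Set.indicator_apply]
  have hind : iIndepFun ξ P := hW.hasIndepIncrements.nat ht
  have hmem : ∀ A : Finset ℕ, MemLp (fun ω => ∏ k ∈ A, ξ k ω) 2 P := by
    exact fun A => memLp_two_prod_of_forall _ fun i _ p hp => hW.memLp_sub _ _ hp
  have hint : ∀ A B : Finset ℕ,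
      Integrable (fun ω => (∏ k ∈ A, ξ k ω) * ∏ k ∈ B, ξ k ω) P := fun A B =>
    (hmem A).integrable_mul (hmem B)
  have hexpect : ∀ A B : Finset ℕ, ∫ ω, (∏ k ∈ A, ξ k ω) * ∏ k ∈ B, ξ k ω ∂P =
      if A = B then w A else 0 := by
    intro A B
    rw [integral_prod_mul_prod_of_iIndepFun hind
      (fun k => (hW.aemeasurable _).sub (hW.aemeasurable _)) (fun k => hW.integral_sub _ _)]
    congr 1
    refine Finset.prod_congr rfl fun k _ => ?_
    rw [hW.integral_sub_sq (ht (Nat.le_succ k)), Real.coe_toNNReal _ (hτT _).1,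
      Real.coe_toNNReal _ (hτT _).1]
  have hL : ∫ ω, simpleIntegral W s ω ^ 2 ∂P = ∑ φ ∈ F, ∑ ψ ∈ F, c φ * c ψ *
      (if Finset.univ.image φ = Finset.univ.image ψ then w (Finset.univ.image φ) else 0) := by
    have : ∀ ω, simpleIntegral W s ω ^ 2 = ∑ φ ∈ F, ∑ ψ ∈ F, c φ * c ψ *
        ((∏ k ∈ Finset.univ.image φ, ξ k ω) * ∏ k ∈ Finset.univ.image ψ, ξ k ω) := by
      intro ω
      rw [hI, sq, Finset.sum_mul_sum]
      exact Finset.sum_congr rfl fun φ _ => Finset.sum_congr rfl fun ψ _ => by ring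
    simp_rw [this]
    rw [integral_finsetSum _ fun φ _ => integrable_finsetSum _ fun ψ _ =>
      (hint _ _).const_mul _]
    refine Finset.sum_congr rfl fun φ _ => ?_
    rw [integral_finsetSum _ fun ψ _ => (hint _ _).const_mul _]
    refine Finset.sum_congr rfl fun ψ _ => ?_
    rw [integral_const_mul, hexpect]
  rw [hL]
  refine (sum_sum_mul_le_of_image_eq F c w hw).trans (le_of_eq ?_)
  simp_rw [hS]
  rw [← sum_sq_le_integral_simpleFun_sq hτ hτT]
  congr 1
  refine Finset.sum_congr rfl fun φ _ => ?_
  rw [sq, mul_assoc, mul_assoc, ← himage φ fun k => τ (k + 1) - τ k]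

theorem ProbabilityTheory.IsBrownianReal.eLpNorm_simpleIntegral_le {Ω : Type*} [MeasurableSpace Ω]
    {P : Measure Ω} {W : ℝ≥0 → Ω → ℝ} (hW : IsBrownianReal W P) {n : ℕ} {T : ℝ} (hT : 0 ≤ T)
    (s : OffDiagBox n T →₀ ℝ) :
    eLpNorm (simpleIntegral W s) 2 P ≤
      ENNReal.ofReal (√((n : ℝ) ^ n)) * eLpNorm (simpleFun s) 2 (cubeMeasure n T) := by
  rw [eLpNorm_two_eq_ofReal_sqrt_integral_sq (hW.memLp_simpleIntegral s),
    eLpNorm_two_eq_ofReal_sqrt_integral_sq (memLp_simpleFun s 2),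
    ← ENNReal.ofReal_mul (Real.sqrt_nonneg _), ← Real.sqrt_mul (by positivity)]
  exact ENNReal.ofReal_le_ofReal (Real.sqrt_le_sqrt (hW.integral_simpleIntegral_sq_le hT s))

/-! ### Density of off-diagonal simple functions -/

/-- The cells of the uniform grid of mesh `T / N` no two coordinates of which are adjacent. -/
def IsSeparatedCell {n N : ℕ} (φ : Fin n → Fin N) : Prop :=
  ∀ i j, i ≠ j → (φ i : ℕ) + 2 ≤ φ j ∨ (φ j : ℕ) + 2 ≤ φ i

/-- The box of the grid of mesh `T / N` with lower corner `φ * T / N`. -/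
noncomputable def gridBox {n N : ℕ} {T : ℝ} (hT : 0 < T) (φ : Fin n → Fin N) (hφ : IsSeparatedCell φ) :
    OffDiagBox n T where
  a i := (φ i : ℝ) * (T / N)
  b i := ((φ i : ℝ) + 1) * (T / N)
  zero_le i := by positivity
  le i := by
    have : 0 ≤ T / N := by positivity
    nlinarith
  le_T i := by
    have hN : (0 : ℝ) < N := by exact_mod_cast (Nat.zero_le _).trans_lt (φ i).2
    have h1 : (φ i : ℝ) + 1 ≤ N := by exact_mod_cast (φ i).2
    calc ((φ i : ℝ) + 1) * (T / N) ≤ N * (T / N) := by gcongr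
      _ = T := by field_simp
  disj i j hij := by
    have hN : (0 : ℝ) < N := by exact_mod_cast (Nat.zero_le _).trans_lt (φ i).2
    have hd : 0 < T / N := by positivity
    refine Set.disjoint_left.2 fun x hx hy => ?_
    -- Indices differing by at least `2` leave a full cell in between; with a difference of `1` the
    -- closed sides would share an endpoint.
    rcases hφ i j hij with h | h
    · have h' : (φ i : ℝ) + 2 ≤ φ j := by exact_mod_cast h
      have := hx.2; have := hy.1
      nlinarith
    · have h' : (φ j : ℝ) + 2 ≤ φ i := by exact_mod_cast h
      have := hx.1; have := hy.2
      nlinarith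

open Classical in
/-- The simple function with value `g (φ * T / N)` on the separated cell `φ` of the grid of mesh
`T / N`. -/
noncomputable def gridSimple {n : ℕ} {T : ℝ} (hT : 0 < T) (g : (Fin n → ℝ) → ℝ) (N : ℕ) :
    OffDiagBox n T →₀ ℝ :=
  ∑ φ : {φ : Fin n → Fin N // IsSeparatedCell φ},
    Finsupp.single (gridBox hT φ.1 φ.2) (g fun i => (φ.1 i : ℝ) * (T / N))

theorem mem_gridBox_iff {n N : ℕ} {T : ℝ} (hT : 0 < T) (φ : Fin n → Fin N)
    (hφ : IsSeparatedCell φ) (x : Fin n → ℝ) :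
    x ∈ (gridBox hT φ hφ).toSet ↔
      ∀ i, (φ i : ℝ) * (T / N) < x i ∧ x i ≤ ((φ i : ℝ) + 1) * (T / N) := by
  simp [OffDiagBox.toSet, gridBox]

theorem simpleFun_gridSimple_of_mem {n N : ℕ} {T : ℝ} (hT : 0 < T) (g : (Fin n → ℝ) → ℝ)
    (φ : Fin n → Fin N) (hφ : IsSeparatedCell φ) {x : Fin n → ℝ}
    (hx : x ∈ (gridBox hT φ hφ).toSet) :
    simpleFun (gridSimple hT g N) x = g fun i => (φ i : ℝ) * (T / N) := by
  classical
  rw [gridSimple, simpleFun_sum_single, Finset.sum_eq_single ⟨φ, hφ⟩]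
  · simp [hx]
  · rintro ⟨ψ, hψ⟩ - hne
    have : x ∉ (gridBox hT ψ hψ).toSet := by
      intro hx'
      refine hne (Subtype.ext (funext fun i => ?_))
      rw [mem_gridBox_iff] at hx hx'
      have hN : (0 : ℝ) < N := by exact_mod_cast (Nat.zero_le _).trans_lt (φ i).2
      have hd : 0 < T / N := by positivity
      have h1 : (φ i : ℝ) < (ψ i : ℝ) + 1 :=
        lt_of_mul_lt_mul_right ((hx i).1.trans_le (hx' i).2) hd.le
      have h2 : (ψ i : ℝ) < (φ i : ℝ) + 1 :=
        lt_of_mul_lt_mul_right ((hx' i).1.trans_le (hx i).2) hd.le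
      have h1' : (φ i : ℕ) < ψ i + 1 := by exact_mod_cast h1
      have h2' : (ψ i : ℕ) < φ i + 1 := by exact_mod_cast h2
      exact Fin.ext (by simp only; omega)
    simp [this]
  · simp

theorem abs_simpleFun_gridSimple_le {n N : ℕ} {T : ℝ} (hT : 0 < T) {g : (Fin n → ℝ) → ℝ} {C : ℝ}
    (hC : ∀ x, |g x| ≤ C) (x : Fin n → ℝ) : |simpleFun (gridSimple hT g N) x| ≤ C := by
  classical
  by_cases h : ∃ (φ : Fin n → Fin N) (hφ : IsSeparatedCell φ), x ∈ (gridBox hT φ hφ).toSet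
  · obtain ⟨φ, hφ, hx⟩ := h
    rw [simpleFun_gridSimple_of_mem hT g φ hφ hx]
    exact hC _
  · push Not at h
    rw [gridSimple, simpleFun_sum_single, Finset.sum_eq_zero]
    · simpa using (abs_nonneg _).trans (hC 0)
    · intro φ _
      simp [h φ.1 φ.2]

theorem exists_mem_gridBox {n N : ℕ} {T : ℝ} (hT : 0 < T) (hN : 0 < N) {x : Fin n → ℝ}
    (h0 : ∀ i, 0 < x i) (hxT : ∀ i, x i ≤ T)
    (hsep : ∀ i j, i ≠ j → 2 * (T / N) < |x i - x j|) :
    ∃ (φ : Fin n → Fin N) (hφ : IsSeparatedCell φ), x ∈ (gridBox hT φ hφ).toSet := by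
  have hN' : (0 : ℝ) < N := by exact_mod_cast hN
  have hd : 0 < T / N := by positivity
  have hceil : ∀ i, 0 < ⌈x i / (T / N)⌉₊ := fun i => Nat.ceil_pos.2 (div_pos (h0 i) hd)
  have hle : ∀ i, ⌈x i / (T / N)⌉₊ ≤ N := by
    intro i
    refine Nat.ceil_le.2 ?_
    rw [div_le_iff₀ hd]
    calc x i ≤ T := hxT i
      _ = N * (T / N) := by field_simp
  -- The sides are open on the left and closed on the right, so the index is the ceiling minus one.
  let φ : Fin n → Fin N := fun i => ⟨⌈x i / (T / N)⌉₊ - 1, by have := hceil i; have := hle i; omega⟩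
  have hval : ∀ i, ((φ i : ℕ) : ℝ) = (⌈x i / (T / N)⌉₊ : ℝ) - 1 := fun i => by
    simp only [φ]
    rw [Nat.cast_sub (hceil i)]
    simp
  have hb : ∀ i, (φ i : ℝ) * (T / N) < x i ∧ x i ≤ ((φ i : ℝ) + 1) * (T / N) := by
    intro i
    rw [hval]
    constructor
    · rw [← lt_div_iff₀ hd]
      linarith [Nat.ceil_lt_add_one (div_nonneg (h0 i).le hd.le)]
    · rw [← div_le_iff₀ hd]
      linarith [Nat.le_ceil (x i / (T / N))]
  have hφ : IsSeparatedCell φ := by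
    intro i j hij
    by_contra! hcon
    have h1 : (φ j : ℝ) + 1 ≤ φ i + 2 := by exact_mod_cast hcon.1
    have h2 : (φ i : ℝ) + 1 ≤ φ j + 2 := by exact_mod_cast hcon.2
    have hbi := hb i
    have hbj := hb j
    rcases lt_abs.1 (hsep i j hij) with h | h <;> nlinarith
  exact ⟨φ, hφ, (mem_gridBox_iff hT φ hφ x).2 hb⟩

/-- The exceptional hyperplanes are kernels of nonzero linear forms, hence null. -/
theorem ae_cubeMeasure_pos_and_injective (n : ℕ) (T : ℝ) :
    ∀ᵐ x ∂cubeMeasure n T, (∀ i, 0 < x i ∧ x i ≤ T) ∧ Function.Injective x := by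
  have hker : ∀ L : (Fin n → ℝ) →ₗ[ℝ] ℝ, L ≠ 0 → ∀ᵐ x : Fin n → ℝ, L x ≠ 0 := by
    intro L hL
    have := Measure.addHaar_submodule (volume : Measure (Fin n → ℝ)) (LinearMap.ker L)
      (fun h => hL (LinearMap.ker_eq_top.1 h))
    rw [ae_iff]
    convert this using 2
    ext x
    simp
  have h1 : ∀ᵐ x : Fin n → ℝ, ∀ i, x i ≠ 0 := by
    refine ae_all_iff.2 fun i => hker (LinearMap.proj i) fun h => ?_
    simpa using LinearMap.congr_fun h (fun _ => 1)
  have h2 : ∀ᵐ x : Fin n → ℝ, ∀ i j, i ≠ j → x i ≠ x j := by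
    refine ae_all_iff.2 fun i => ae_all_iff.2 fun j => ?_
    by_cases hij : i = j
    · simp [hij]
    · let L : (Fin n → ℝ) →ₗ[ℝ] ℝ :=
        (LinearMap.proj i : (Fin n → ℝ) →ₗ[ℝ] ℝ) - LinearMap.proj j
      have hL : L ≠ 0 := by
        intro h
        have h' : (Pi.single i 1 : Fin n → ℝ) i - (Pi.single i 1 : Fin n → ℝ) j = 0 :=
          LinearMap.congr_fun h (Pi.single i 1)
        simp [Ne.symm hij] at h'
      filter_upwards [hker L hL] with x hx _ h
      exact hx (sub_eq_zero.2 h)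
  filter_upwards [ae_restrict_of_ae h1, ae_restrict_of_ae h2,
    ae_restrict_mem (measurableSet_cube n T)] with x hx1 hx2 hx3
  refine ⟨fun i => ⟨lt_of_le_of_ne (hx3 i (Set.mem_univ _)).1 (hx1 i).symm,
    (hx3 i (Set.mem_univ _)).2⟩, fun i j hij => ?_⟩
  by_contra h
  exact hx2 i j h hij

/-- Once the mesh is small compared with the gaps between coordinates, the cell of `x` is separated,
and its lower corner is within `T / N` of `x`. -/
theorem tendsto_simpleFun_gridSimple {n : ℕ} {T : ℝ} (hT : 0 < T) {g : (Fin n → ℝ) → ℝ}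
    (hg : Continuous g) {x : Fin n → ℝ} (hx : ∀ i, 0 < x i ∧ x i ≤ T)
    (hinj : Function.Injective x) :
    Tendsto (fun N => simpleFun (gridSimple hT g N) x) atTop (𝓝 (g x)) := by
  have hlim : Tendsto (fun N : ℕ => T / (N : ℝ)) atTop (𝓝 0) := tendsto_const_div_atTop_nhds_zero_nat T
  have hsep : ∀ᶠ N : ℕ in atTop, ∀ i j, i ≠ j → 2 * (T / (N : ℝ)) < |x i - x j| := by
    refine eventually_all.2 fun i => eventually_all.2 fun j => ?_
    by_cases hij : i = j
    · simp [hij]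
    · have h1 : 0 < |x i - x j| := abs_pos.2 (sub_ne_zero.2 fun h => hij (hinj h))
      have h2 := hlim.const_mul 2
      rw [mul_zero] at h2
      filter_upwards [h2.eventually_lt_const h1] with N hN _ using hN
  rw [Metric.tendsto_nhds]
  intro δ hδ
  obtain ⟨ρ, hρ, hgρ⟩ := Metric.continuous_iff.1 hg x δ hδ
  filter_upwards [hsep, hlim.eventually_lt_const hρ, eventually_gt_atTop 0] with N h1 h2 h3
  obtain ⟨φ, hφ, hmem⟩ := exists_mem_gridBox hT h3 (fun i => (hx i).1) (fun i => (hx i).2) h1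
  rw [simpleFun_gridSimple_of_mem hT g φ hφ hmem]
  refine hgρ _ ((dist_pi_lt_iff hρ).2 fun i => ?_)
  have := (mem_gridBox_iff hT φ hφ x).1 hmem i
  rw [Real.dist_eq, abs_lt]
  constructor <;> linarith

/-- Dominated convergence: almost every point has distinct positive coordinates, and the bound of
`g` also bounds its discretizations. -/
theorem tendsto_eLpNorm_sub_gridSimple {n : ℕ} {T : ℝ} (hT : 0 < T) {g : (Fin n → ℝ) → ℝ}
    (hg : Continuous g) (hgs : HasCompactSupport g) :
    Tendsto (fun N => eLpNorm (fun x => g x - simpleFun (gridSimple hT g N) x) 2 (cubeMeasure n T))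
      atTop (𝓝 0) := by
  obtain ⟨C, hC⟩ := hg.bounded_above_of_compact_support hgs
  have hgm : MemLp g 2 (cubeMeasure n T) :=
    MemLp.of_bound hg.aestronglyMeasurable C (ae_of_all _ hC)
  have hmem : ∀ N, MemLp (fun x => g x - simpleFun (gridSimple hT g N) x) 2 (cubeMeasure n T) :=
    fun N => hgm.sub (memLp_simpleFun _ 2)
  simp_rw [fun N => eLpNorm_two_eq_ofReal_sqrt_integral_sq (hmem N)]
  have hI : Tendsto (fun N => ∫ x, (g x - simpleFun (gridSimple hT g N) x) ^ 2 ∂cubeMeasure n T)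
      atTop (𝓝 (∫ _, 0 ∂cubeMeasure n T)) := by
    refine tendsto_integral_of_dominated_convergence (fun _ => (C + C) ^ 2)
      (fun N => (hmem N).integrable_sq.aestronglyMeasurable) (integrable_const _)
      (fun N => ae_of_all _ fun x => ?_) ?_
    · rw [Real.norm_eq_abs, abs_pow]
      exact pow_le_pow_left₀ (abs_nonneg _) ((abs_sub _ _).trans
        (add_le_add (hC x) (abs_simpleFun_gridSimple_le hT hC x))) 2
    · filter_upwards [ae_cubeMeasure_pos_and_injective n T] with x hx
      have := ((tendsto_simpleFun_gridSimple hT hg hx.1 hx.2).const_sub (g x)).pow 2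
      simpa using this
  rw [integral_zero] at hI
  have := ENNReal.tendsto_ofReal ((Real.continuous_sqrt.tendsto _).comp hI)
  simpa using this

theorem exists_eLpNorm_sub_simpleFun_le {n : ℕ} {T : ℝ} (hT : 0 < T) {f : (Fin n → ℝ) → ℝ}
    (hf : MemLp f 2 (cubeMeasure n T)) {δ : ℝ≥0∞} (hδ : δ ≠ 0) :
    ∃ s : OffDiagBox n T →₀ ℝ, eLpNorm (fun x => f x - simpleFun s x) 2 (cubeMeasure n T) ≤ δ := by
  have hδ2 : δ / 2 ≠ 0 := by simp [hδ]
  obtain ⟨g, hgs, hfg, hg, hgm⟩ := hf.exists_hasCompactSupport_eLpNorm_sub_le (by norm_num) hδ2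
  obtain ⟨N, hN⟩ := ((tendsto_eLpNorm_sub_gridSimple hT hg hgs).eventually_le_const
    (pos_iff_ne_zero.2 hδ2)).exists
  refine ⟨gridSimple hT g N, ?_⟩
  have h1 : (fun x => f x - simpleFun (gridSimple hT g N) x) =
      (f - g) + fun x => g x - simpleFun (gridSimple hT g N) x := by
    ext x; simp
  rw [h1]
  refine (eLpNorm_add_le (hf.sub hgm).1 (hgm.sub (memLp_simpleFun _ 2)).1 (by norm_num)).trans ?_
  exact (add_le_add hfg hN).trans_eq (ENNReal.add_halves δ)

theorem exists_tendsto_eLpNorm_sub_simpleFun {n : ℕ} {T : ℝ} (hT : 0 < T) {f : (Fin n → ℝ) → ℝ}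
    (hf : MemLp f 2 (cubeMeasure n T)) :
    ∃ s : ℕ → (OffDiagBox n T →₀ ℝ),
      Tendsto (fun m => eLpNorm (fun x => f x - simpleFun (s m) x) 2 (cubeMeasure n T))
        atTop (𝓝 0) := by
  have h : ∀ m : ℕ, ∃ s : OffDiagBox n T →₀ ℝ,
      eLpNorm (fun x => f x - simpleFun s x) 2 (cubeMeasure n T) ≤ ((m : ℝ≥0∞))⁻¹ := fun m =>
    exists_eLpNorm_sub_simpleFun_le hT hf (by simp)
  choose s hs using h
  exact ⟨s, tendsto_of_tendsto_of_tendsto_of_le_of_le tendsto_const_nhds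
    ENNReal.tendsto_inv_nat_nhds_zero (fun _ => zero_le) hs⟩

/-! ### Existence of the multiple Wiener-Itô integral -/

/-- The second moment estimate, applied to differences of approximating simple functions, makes
their integrals Cauchy in the complete space `L²(P)`. -/
theorem ProbabilityTheory.IsBrownianReal.exists_isMultipleWienerIntegral {Ω : Type*}
    [MeasurableSpace Ω] {P : Measure Ω} {W : ℝ≥0 → Ω → ℝ} (hW : IsBrownianReal W P) {n : ℕ}
    {T : ℝ} (hT : 0 < T) {f : (Fin n → ℝ) → ℝ} (hf : MemLp f 2 (cubeMeasure n T)) :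
    ∃ X, IsMultipleWienerIntegral W P T f X := by
  obtain ⟨s, hs⟩ := exists_tendsto_eLpNorm_sub_simpleFun hT hf
  have hmem : ∀ m, MemLp (simpleIntegral W (s m)) 2 P := fun m => hW.memLp_simpleIntegral _
  let K := ENNReal.ofReal (√((n : ℝ) ^ n))
  let e := fun m => eLpNorm (fun x => f x - simpleFun (s m) x) 2 (cubeMeasure n T)
  have hle : ∀ k m, eLpNorm (simpleIntegral W (s k) - simpleIntegral W (s m)) 2 P ≤
      K * (e k + e m) := by
    intro k m
    have h1 : simpleIntegral W (s k) - simpleIntegral W (s m) = simpleIntegral W (s k - s m) :=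
      funext fun ω => (simpleIntegral_sub W _ _ ω).symm
    rw [h1]
    refine (hW.eLpNorm_simpleIntegral_le hT.le _).trans (mul_le_mul_right ?_ _)
    have h2 : simpleFun (s k - s m) =
        (fun x => f x - simpleFun (s m) x) - fun x => f x - simpleFun (s k) x := by
      ext x
      simp [simpleFun_sub]
    rw [h2, add_comm]
    exact eLpNorm_sub_le (hf.sub (memLp_simpleFun _ 2)).1 (hf.sub (memLp_simpleFun _ 2)).1
      (by norm_num)
  have hc : CauchySeq fun m => (hmem m).toLp := by
    rw [Lp.cauchySeq_Lp_iff_cauchySeq_eLpNorm]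
    have hlim : Tendsto (fun p : ℕ × ℕ => K * (e p.1 + e p.2)) atTop (𝓝 0) := by
      have h1 : Tendsto (fun p : ℕ × ℕ => e p.1 + e p.2) atTop (𝓝 (0 + 0)) := by
        rw [← prod_atTop_atTop_eq]
        exact (hs.comp tendsto_fst).add (hs.comp tendsto_snd)
      have h2 := ENNReal.Tendsto.const_mul (a := K) h1 (Or.inr ENNReal.ofReal_ne_top)
      simpa using h2
    refine tendsto_of_tendsto_of_tendsto_of_le_of_le tendsto_const_nhds hlim (fun _ => zero_le)
      fun p => ?_
    refine le_trans (le_of_eq ?_) (hle p.1 p.2)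
    exact eLpNorm_congr_ae ((hmem p.1).coeFn_toLp.sub (hmem p.2).coeFn_toLp)
  obtain ⟨X, hX⟩ := cauchySeq_tendsto_of_complete hc
  refine ⟨X, Lp.memLp X, s, hs, ?_⟩
  rw [Lp.tendsto_Lp_iff_tendsto_eLpNorm'] at hX
  refine hX.congr fun m => ?_
  rw [eLpNorm_sub_comm]
  refine eLpNorm_congr_ae ?_
  filter_upwards [(hmem m).coeFn_toLp] with ω hω
  simp [hω]

/-! ### The approximating integral along a fixed path -/

theorem cubeMeasure_eq_pi (n : ℕ) (T : ℝ) :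
    cubeMeasure n T = Measure.pi fun _ : Fin n => volume.restrict (Set.Icc 0 T) :=
  Measure.restrict_pi_pi _ _

theorem memLp_prod_cubeMeasure {T : ℝ} {v : ℝ → ℝ}
    (hv : MemLp v 2 (volume.restrict (Set.Icc 0 T))) (n : ℕ) :
    MemLp (fun x : Fin n → ℝ => ∏ i, v (x i)) 2 (cubeMeasure n T) := by
  rw [cubeMeasure_eq_pi]
  have h1 : Integrable v (volume.restrict (Set.Icc 0 T)) := hv.integrable (by norm_num)
  rw [memLp_two_iff_integrable_sq (Integrable.fintype_prod fun _ => h1).aestronglyMeasurable]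
  simp_rw [← Finset.prod_pow]
  exact Integrable.fintype_prod (f := fun (_ : Fin n) y => v y ^ 2) fun _ => hv.integrable_sq

/-- The indicator function of the points all of whose coordinates are at distance more than `ε`
from each other. -/
noncomputable def offDiagKernel (n : ℕ) (ε : ℝ) (x : Fin n → ℝ) : ℝ :=
  ∏ p ∈ (Finset.univ : Finset (Fin n)).offDiag, if ε < |x p.1 - x p.2| then (1 : ℝ) else 0

theorem measurable_offDiagKernel (n : ℕ) (ε : ℝ) : Measurable (offDiagKernel n ε) := by
  unfold offDiagKernel
  exact Finset.measurable_prod _ fun p _ =>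
    Measurable.ite (measurableSet_lt measurable_const (by fun_prop)) measurable_const
      measurable_const

theorem abs_offDiagKernel_le (n : ℕ) (ε : ℝ) (x : Fin n → ℝ) : |offDiagKernel n ε x| ≤ 1 := by
  unfold offDiagKernel
  rw [Finset.abs_prod]
  refine Finset.prod_le_one (fun _ _ => abs_nonneg _) fun p _ => ?_
  split_ifs <;> simp

theorem memLp_mul_offDiagKernel {n : ℕ} {T : ℝ} {f : (Fin n → ℝ) → ℝ}
    (hf : MemLp f 2 (cubeMeasure n T)) (ε : ℝ) :
    MemLp (fun x => f x * offDiagKernel n ε x) 2 (cubeMeasure n T) := by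
  refine hf.mono (hf.1.mul (measurable_offDiagKernel n ε).aestronglyMeasurable)
    (ae_of_all _ fun x => ?_)
  rw [Real.norm_eq_abs, Real.norm_eq_abs, abs_mul]
  exact mul_le_of_le_one_right (abs_nonneg _) (abs_offDiagKernel_le n ε x)

/-- The integral of `g` against the `n`-fold tensor power of the path `v` over `[0,T]^n`. -/
noncomputable def tensorIntegral {n : ℕ} (T : ℝ) (v : ℝ → ℝ) (g : (Fin n → ℝ) → ℝ) : ℝ :=
  ∫ x, g x * ∏ i, v (x i) ∂cubeMeasure n T

/-- Moving `t` into the integrand leaves only integrals over `[0,T]^n` to study. -/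
theorem offDiagIntegral_eq_indicator {Ω : Type*} {n : ℕ} (ε : ℝ) (θ : ℝ → Ω → ℝ)
    (f : (Fin n → ℝ) → ℝ) {t T : ℝ} (htT : t ≤ T) (ω : Ω) :
    offDiagIntegral ε θ f t ω = offDiagIntegral ε θ ((cube n t).indicator f) T ω := by
  have hsub : cube n t ⊆ cube n T := Set.pi_mono fun _ _ => Set.Icc_subset_Icc_right htT
  unfold offDiagIntegral
  have h : ∀ x, (cube n t).indicator f x * (∏ i, θ (x i) ω) * offDiagKernel n ε x =
      (cube n t).indicator (fun x => f x * (∏ i, θ (x i) ω) * offDiagKernel n ε x) x := by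
    intro x
    by_cases hx : x ∈ cube n t <;> simp [hx]
  change _ = ∫ x in cube n T, (cube n t).indicator f x * (∏ i, θ (x i) ω) * offDiagKernel n ε x
  simp_rw [h]
  rw [setIntegral_indicator (measurableSet_cube n t), Set.inter_eq_right.2 hsub]
  rfl

theorem offDiagIntegral_eq_tensorIntegral {Ω : Type*} {n : ℕ} (ε : ℝ) (θ : ℝ → Ω → ℝ)
    (f : (Fin n → ℝ) → ℝ) (T : ℝ) (ω : Ω) :
    offDiagIntegral ε θ f T ω =
      tensorIntegral T (fun s => θ s ω) fun x => f x * offDiagKernel n ε x := by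
  unfold offDiagIntegral tensorIntegral
  exact integral_congr_ae (ae_of_all _ fun x => mul_right_comm _ _ _)

section Path

variable {n : ℕ} {T : ℝ} {v : ℝ → ℝ}

theorem integrable_tensorIntegrand (hv : MemLp v 2 (volume.restrict (Set.Icc 0 T)))
    {g : (Fin n → ℝ) → ℝ} (hg : MemLp g 2 (cubeMeasure n T)) :
    Integrable (fun x => g x * ∏ i, v (x i)) (cubeMeasure n T) :=
  hg.integrable_mul (memLp_prod_cubeMeasure hv n)

theorem tensorIntegral_sub (hv : MemLp v 2 (volume.restrict (Set.Icc 0 T)))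
    {g h : (Fin n → ℝ) → ℝ} (hg : MemLp g 2 (cubeMeasure n T))
    (hh : MemLp h 2 (cubeMeasure n T)) :
    tensorIntegral T v (fun x => g x - h x) = tensorIntegral T v g - tensorIntegral T v h := by
  unfold tensorIntegral
  rw [← integral_sub (integrable_tensorIntegrand hv hg) (integrable_tensorIntegrand hv hh)]
  simp_rw [sub_mul]

/-- Cauchy–Schwarz against the tensor power of `v`. The modulus of continuity depends on the path;
this is used only for measurability in `ω`. -/
theorem tendsto_tensorIntegral (hv : MemLp v 2 (volume.restrict (Set.Icc 0 T)))
    {g : (Fin n → ℝ) → ℝ} (hg : MemLp g 2 (cubeMeasure n T)) {h : ℕ → (Fin n → ℝ) → ℝ}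
    (hh : ∀ m, MemLp (h m) 2 (cubeMeasure n T))
    (hlim : Tendsto (fun m => eLpNorm (fun x => g x - h m x) 2 (cubeMeasure n T)) atTop (𝓝 0)) :
    Tendsto (fun m => tensorIntegral T v (h m)) atTop (𝓝 (tensorIntegral T v g)) := by
  have hp := memLp_prod_cubeMeasure hv n
  refine tendsto_integral_of_L1' _ (integrable_tensorIntegrand hv hg).aestronglyMeasurable
    (Eventually.of_forall fun m => integrable_tensorIntegrand hv (hh m)) ?_
  have h2 := ENNReal.Tendsto.mul_const (b := eLpNorm (fun x : Fin n → ℝ => ∏ i, v (x i)) 2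
    (cubeMeasure n T)) hlim (Or.inr hp.2.ne)
  rw [zero_mul] at h2
  refine tendsto_of_tendsto_of_tendsto_of_le_of_le tendsto_const_nhds h2 (fun _ => zero_le)
    fun m => ?_
  refine le_trans (le_of_eq ?_)
    (eLpNorm_smul_le_mul_eLpNorm (p := 2) (q := 2) (r := 1) hp.1 (hg.sub (hh m)).1)
  rw [eLpNorm_sub_comm]
  congr 1
  ext x
  simp [sub_mul]

theorem intervalIntegral_sub_eq_setIntegral (hv : MemLp v 2 (volume.restrict (Set.Icc 0 T)))
    {a b : ℝ} (ha : 0 ≤ a) (hab : a ≤ b) (hb : b ≤ T) :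
    (∫ s in (0 : ℝ)..b, v s) - ∫ s in (0 : ℝ)..a, v s = ∫ s in Set.Ioc a b, v s := by
  have h1 : IntegrableOn v (Set.Icc 0 T) := hv.integrable (by norm_num)
  have h2 : ∀ c, 0 ≤ c → c ≤ T → IntervalIntegrable v volume 0 c := fun c hc hcT =>
    (intervalIntegrable_iff_integrableOn_Icc_of_le hc).2
      (h1.mono_set (Set.Icc_subset_Icc_right hcT))
  rw [intervalIntegral.integral_interval_sub_left (h2 b (ha.trans hab) hb)
    (h2 a ha (hab.trans hb)), intervalIntegral.integral_of_le hab]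

theorem tensorIntegral_indicator_toSet (hv : MemLp v 2 (volume.restrict (Set.Icc 0 T)))
    (Δ : OffDiagBox n T) :
    tensorIntegral T v (Δ.toSet.indicator fun _ => (1 : ℝ)) =
      ∏ i, ((∫ s in (0 : ℝ)..Δ.b i, v s) - ∫ s in (0 : ℝ)..Δ.a i, v s) := by
  have hsub : Δ.toSet ⊆ cube n T := Set.pi_mono fun i _ x hx =>
    ⟨(Δ.zero_le i).trans hx.1.le, hx.2.trans (Δ.le_T i)⟩
  unfold tensorIntegral
  have h : ∀ x, Δ.toSet.indicator (fun _ => (1 : ℝ)) x * ∏ i, v (x i) =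
      Δ.toSet.indicator (fun x => ∏ i, v (x i)) x := by
    intro x
    by_cases hx : x ∈ Δ.toSet <;> simp [hx]
  simp_rw [h]
  rw [integral_indicator Δ.measurableSet_toSet, cubeMeasure,
    Measure.restrict_restrict Δ.measurableSet_toSet, Set.inter_eq_left.2 hsub, OffDiagBox.toSet,
    volume_pi, Measure.restrict_pi_pi, integral_fintype_prod_eq_prod (f := fun _ y => v y)]
  exact Finset.prod_congr rfl fun i _ =>
    (intervalIntegral_sub_eq_setIntegral hv (Δ.zero_le i) (Δ.le i) (Δ.le_T i)).symm

theorem tensorIntegral_simpleFun (hv : MemLp v 2 (volume.restrict (Set.Icc 0 T)))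
    (s : OffDiagBox n T →₀ ℝ) :
    tensorIntegral T v (simpleFun s) = s.sum fun Δ α =>
      α * ∏ i, ((∫ u in (0 : ℝ)..Δ.b i, v u) - ∫ u in (0 : ℝ)..Δ.a i, v u) := by
  unfold Finsupp.sum
  simp_rw [← tensorIntegral_indicator_toSet hv]
  unfold tensorIntegral simpleFun Finsupp.sum
  simp_rw [Finset.sum_mul, mul_assoc]
  rw [integral_finsetSum]
  · simp_rw [integral_const_mul]
  · exact fun Δ _ => (integrable_tensorIntegrand hv
      ((memLp_const (1 : ℝ)).indicator Δ.measurableSet_toSet)).const_mul _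

end Path

/-! ### Simple integrands for small `ε`, and measurability -/

theorem OffDiagBox.eventually_offDiagKernel_eq_one {n : ℕ} {T : ℝ} (Δ : OffDiagBox n T) :
    ∀ᶠ ε in 𝓝[>] (0 : ℝ), ∀ x ∈ Δ.toSet, offDiagKernel n ε x = 1 := by
  have h : ∀ i j, i ≠ j → ∀ᶠ ε in 𝓝[>] (0 : ℝ), ∀ x ∈ Δ.toSet, ε < |x i - x j| := by
    have key : ∀ i j, Δ.b i < Δ.a j →
        ∀ᶠ ε in 𝓝[>] (0 : ℝ), ∀ x ∈ Δ.toSet, ε < |x i - x j| := by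
      intro i j hlt
      filter_upwards [Ioo_mem_nhdsGT (sub_pos.2 hlt)] with ε hε x hx
      have h1 := hx i (Set.mem_univ _)
      have h2 := hx j (Set.mem_univ _)
      rw [abs_sub_comm]
      refine lt_of_lt_of_le ?_ (le_abs_self _)
      have := hε.2
      have := h1.2
      have := h2.1
      linarith
    intro i j hij
    rcases lt_or_ge (Δ.b i) (Δ.a j) with hlt | hge
    · exact key i j hlt
    · have hlt : Δ.b j < Δ.a i := by
        -- If neither interval lies strictly to the left of the other, the larger left endpoint
        -- belongs to both.
        by_contra! hle
        have hd := Set.disjoint_left.1 (Δ.disj i j hij)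
        rcases le_total (Δ.a i) (Δ.a j) with h | h
        · exact hd ⟨h, hge⟩ ⟨le_rfl, Δ.le j⟩
        · exact hd ⟨le_rfl, Δ.le i⟩ ⟨h, hle⟩
      filter_upwards [key j i hlt] with ε hε x hx
      rw [abs_sub_comm]
      exact hε x hx
  have hall : ∀ᶠ ε in 𝓝[>] (0 : ℝ), ∀ i j, i ≠ j → ∀ x ∈ Δ.toSet, ε < |x i - x j| := by
    refine eventually_all.2 fun i => eventually_all.2 fun j => ?_
    by_cases hij : i = j
    · simp [hij]
    · filter_upwards [h i j hij] with ε hε _ using hε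
  filter_upwards [hall] with ε hε x hx
  exact Finset.prod_eq_one fun p hp => if_pos (hε _ _ (Finset.mem_offDiag.1 hp).2.2 x hx)

theorem eventually_simpleFun_mul_offDiagKernel {n : ℕ} {T : ℝ} (s : OffDiagBox n T →₀ ℝ) :
    ∀ᶠ ε in 𝓝[>] (0 : ℝ), ∀ x, simpleFun s x * offDiagKernel n ε x = simpleFun s x := by
  have : ∀ᶠ ε in 𝓝[>] (0 : ℝ), ∀ Δ ∈ s.support, ∀ x ∈ Δ.toSet, offDiagKernel n ε x = 1 :=
    (Finset.eventually_all _).2 fun Δ _ => Δ.eventually_offDiagKernel_eq_one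
  filter_upwards [this] with ε hε x
  unfold simpleFun Finsupp.sum
  rw [Finset.sum_mul]
  refine Finset.sum_congr rfl fun Δ hΔ => ?_
  by_cases hx : x ∈ Δ.toSet
  · rw [hε Δ hΔ x hx, mul_one]
  · simp [hx]

/-- The sum `∑ₖ αₖ ∏ᵢ (η(bₖⁱ) - η(aₖⁱ))` attached to a formal combination of boxes and a path. -/
noncomputable def incrementSum {n : ℕ} {T : ℝ} (s : OffDiagBox n T →₀ ℝ) (y : ℝ → ℝ) : ℝ :=
  s.sum fun Δ α => α * ∏ i, (y (Δ.b i) - y (Δ.a i))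

/-- The threshold for `ε` depends on `s` alone; uniformity over `Ω` and `θ` is needed because both
vary with `ε`. -/
theorem eventually_offDiagIntegral_simpleFun {n : ℕ} {T : ℝ} (s : OffDiagBox n T →₀ ℝ) :
    ∀ᶠ ε in 𝓝[>] (0 : ℝ), ∀ {Ω : Type*} (θ : ℝ → Ω → ℝ) (ω : Ω),
      MemLp (fun u => θ u ω) 2 (volume.restrict (Set.Icc 0 T)) →
      offDiagIntegral ε θ (simpleFun s) T ω = incrementSum s fun t => etaProcess θ t ω := by
  filter_upwards [eventually_simpleFun_mul_offDiagKernel s] with ε hε Ω θ ω hω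
  rw [offDiagIntegral_eq_tensorIntegral]
  simp_rw [hε]
  exact tensorIntegral_simpleFun hω s

theorem offDiagIntegral_sub {Ω : Type*} {θ : ℝ → Ω → ℝ} {n : ℕ} {T : ℝ} {ω : Ω}
    (hω : MemLp (fun s => θ s ω) 2 (volume.restrict (Set.Icc 0 T)))
    {f g : (Fin n → ℝ) → ℝ} (hf : MemLp f 2 (cubeMeasure n T)) (hg : MemLp g 2 (cubeMeasure n T))
    (ε : ℝ) :
    offDiagIntegral ε θ (fun x => f x - g x) T ω =
      offDiagIntegral ε θ f T ω - offDiagIntegral ε θ g T ω := by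
  simp_rw [offDiagIntegral_eq_tensorIntegral, sub_mul]
  exact tensorIntegral_sub hω (memLp_mul_offDiagKernel hf ε) (memLp_mul_offDiagKernel hg ε)

/-- No joint measurability of `θ` is available. Approximating `f` times the kernel by simple
functions exhibits the integral as an almost sure limit of polynomials in values of `η`. -/
theorem aemeasurable_offDiagIntegral {Ω : Type*} [MeasurableSpace Ω] {P : Measure Ω}
    {θ : ℝ → Ω → ℝ} {n : ℕ} {T : ℝ} (hT : 0 < T)
    (hθ : ∀ᵐ ω ∂P, MemLp (fun s => θ s ω) 2 (volume.restrict (Set.Icc 0 T)))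
    (hη : ∀ t ∈ Set.Icc 0 T, AEMeasurable (etaProcess θ t) P)
    {f : (Fin n → ℝ) → ℝ} (hf : MemLp f 2 (cubeMeasure n T)) (ε : ℝ) :
    AEMeasurable (offDiagIntegral ε θ f T) P := by
  obtain ⟨s, hs⟩ := exists_tendsto_eLpNorm_sub_simpleFun hT (memLp_mul_offDiagKernel hf ε)
  refine aemeasurable_of_tendsto_metrizable_ae atTop
    (f := fun m ω => incrementSum (s m) fun t => etaProcess θ t ω) (fun m => ?_) ?_
  · unfold incrementSum Finsupp.sum
    refine Finset.aemeasurable_fun_sum _ fun Δ _ => AEMeasurable.const_mul ?_ _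
    refine Finset.aemeasurable_fun_prod _ fun i _ => AEMeasurable.sub ?_ ?_
    · exact hη _ ⟨(Δ.zero_le i).trans (Δ.le i), Δ.le_T i⟩
    · exact hη _ ⟨Δ.zero_le i, (Δ.le i).trans (Δ.le_T i)⟩
  · filter_upwards [hθ] with ω hω
    rw [offDiagIntegral_eq_tensorIntegral]
    refine (tendsto_tensorIntegral hω (memLp_mul_offDiagKernel hf ε)
      (fun m => memLp_simpleFun (s m) 2) hs).congr fun m => ?_
    exact tensorIntegral_simpleFun hω (s m)

/-! ### Convergence in law by approximation -/

theorem LipschitzWith.edist_integral_map_le {Ω E : Type*} [MeasurableSpace Ω] {μ : Measure Ω}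
    [IsFiniteMeasure μ] [NormedAddCommGroup E] [MeasurableSpace E] [BorelSpace E]
    {F : E → ℝ} {L : ℝ≥0} (hL : LipschitzWith L F) {C : ℝ} (hC : ∀ x y, dist (F x) (F y) ≤ C)
    {X Y : Ω → E} (hX : AEMeasurable X μ) (hY : AEMeasurable Y μ) :
    edist (∫ x, F x ∂(μ.map X)) (∫ x, F x ∂(μ.map Y)) ≤ L * ∫⁻ ω, ‖X ω - Y ω‖ₑ ∂μ := by
  have hint : ∀ Z : Ω → E, AEMeasurable Z μ → Integrable (fun ω => F (Z ω)) μ := by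
    intro Z hZ
    refine Integrable.of_bound
      (hL.continuous.measurable.comp_aemeasurable hZ).aestronglyMeasurable (‖F 0‖ + C)
      (ae_of_all _ fun ω => ?_)
    have h1 := norm_sub_norm_le (F (Z ω)) (F 0)
    have h2 := hC (Z ω) 0
    rw [dist_eq_norm] at h2
    linarith
  rw [integral_map hX hL.continuous.aestronglyMeasurable,
    integral_map hY hL.continuous.aestronglyMeasurable, edist_eq_enorm_sub,
    ← integral_sub (hint X hX) (hint Y hY), ← lintegral_const_mul' _ _ ENNReal.coe_ne_top]
  refine (enorm_integral_le_lintegral_enorm _).trans (lintegral_mono fun ω => ?_)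
  simpa only [edist_eq_enorm_sub] using hL (X ω) (Y ω)

/-- A family of random variables which is approximated in `L¹`, eventually uniformly, by families
converging in distribution to approximations of `Z`, converges in distribution to `Z`. -/
theorem tendstoInDistribution_of_approx {ι Ω' E : Type*} {Ω : ι → Type*}
    [∀ i, MeasurableSpace (Ω i)] [MeasurableSpace Ω'] {μ : ∀ i, Measure (Ω i)}
    [∀ i, IsProbabilityMeasure (μ i)] {μ' : Measure Ω'} [IsProbabilityMeasure μ']
    [NormedAddCommGroup E] [MeasurableSpace E] [BorelSpace E]
    {l : Filter ι} [l.IsCountablyGenerated] {X : ∀ i, Ω i → E} {Z : Ω' → E}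
    {Y : ℕ → ∀ i, Ω i → E} {U : ℕ → Ω' → E} {δ : ℕ → ℝ≥0∞}
    (hX : ∀ i, AEMeasurable (X i) (μ i)) (hZ : AEMeasurable Z μ')
    (hY : ∀ m, TendstoInDistribution (Y m) l (U m) μ μ')
    (hXY : ∀ m, ∀ᶠ i in l, ∫⁻ ω, ‖X i ω - Y m i ω‖ₑ ∂μ i ≤ δ m)
    (hZU : ∀ m, ∫⁻ ω, ‖Z ω - U m ω‖ₑ ∂μ' ≤ δ m) (hδ : Tendsto δ atTop (𝓝 0)) :
    TendstoInDistribution X l Z μ μ' := by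
  -- Bounded Lipschitz test functions suffice, and for these an `L¹` distance controls the
  -- difference of expectations.
  refine ⟨hX, hZ, tendsto_iff_forall_lipschitz_integral_tendsto.2 ?_⟩
  rintro F ⟨C, hC⟩ ⟨L, hL⟩
  rw [EMetric.tendsto_nhds]
  intro e he
  have he3 : 0 < e / 3 := ENNReal.div_pos he.ne' (by simp)
  have hLδ : Tendsto (fun m => (L : ℝ≥0∞) * δ m) atTop (𝓝 0) := by
    simpa using ENNReal.Tendsto.const_mul (a := (L : ℝ≥0∞)) hδ (Or.inr ENNReal.coe_ne_top)
  obtain ⟨m, hm⟩ := (hLδ.eventually_lt_const he3).exists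
  have hYm := EMetric.tendsto_nhds.1
    (tendsto_iff_forall_lipschitz_integral_tendsto.1 (hY m).tendsto F ⟨C, hC⟩ ⟨L, hL⟩) (e / 3) he3
  filter_upwards [hYm, hXY m] with i hi1 hi2
  have h1 := (hL.edist_integral_map_le hC (hX i) ((hY m).forall_aemeasurable i)).trans
    (mul_le_mul_right hi2 _)
  have h2 := (hL.edist_integral_map_le hC hZ (hY m).aemeasurable_limit).trans
    (mul_le_mul_right (hZU m) _)
  rw [edist_comm] at h2
  calc _ ≤ _ := edist_triangle4 _ _ _ _
    _ < e / 3 + e / 3 + e / 3 :=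
      ENNReal.add_lt_add (ENNReal.add_lt_add (h1.trans_lt hm) hi1) (h2.trans_lt hm)
    _ = e := ENNReal.add_thirds e

theorem incrementSum_congr {n : ℕ} {T : ℝ} (s : OffDiagBox n T →₀ ℝ) {y z : ℝ → ℝ}
    (h : ∀ Δ ∈ s.support, ∀ i, y (Δ.a i) = z (Δ.a i) ∧ y (Δ.b i) = z (Δ.b i)) :
    incrementSum s y = incrementSum s z := by
  refine Finset.sum_congr rfl fun Δ hΔ => ?_
  simp only
  congr 1
  exact Finset.prod_congr rfl fun i _ => by rw [(h Δ hΔ i).1, (h Δ hΔ i).2]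

theorem enorm_pi_pi_le_sum {r d : ℕ} (x : Fin r → Fin d → ℝ) : ‖x‖ₑ ≤ ∑ j, ∑ k, ‖x j k‖ₑ := by
  rw [← edist_zero_right]
  refine edist_pi_le_iff.2 fun j => edist_pi_le_iff.2 fun k => ?_
  rw [Pi.zero_apply, Pi.zero_apply, edist_zero_right]
  exact (Finset.single_le_sum (f := fun k => ‖x j k‖ₑ) (fun _ _ => zero_le)
    (Finset.mem_univ k)).trans (Finset.single_le_sum (f := fun j => ∑ k, ‖x j k‖ₑ)
      (fun _ _ => zero_le) (Finset.mem_univ j))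

theorem lintegral_enorm_pi_pi_le {Ω : Type*} [MeasurableSpace Ω] {μ : Measure Ω} {r d : ℕ}
    {X : Ω → Fin r → Fin d → ℝ} (hX : ∀ j k, AEMeasurable (fun ω => X ω j k) μ)
    {δ : Fin r → Fin d → ℝ≥0∞} (hδ : ∀ j k, ∫⁻ ω, ‖X ω j k‖ₑ ∂μ ≤ δ j k) :
    ∫⁻ ω, ‖X ω‖ₑ ∂μ ≤ ∑ j, ∑ k, δ j k := by
  refine (lintegral_mono fun ω => enorm_pi_pi_le_sum (X ω)).trans ?_
  rw [lintegral_finsetSum' _ fun j _ => Finset.aemeasurable_fun_sum _ fun k _ => (hX j k).enorm]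
  refine Finset.sum_le_sum fun j _ => ?_
  rw [lintegral_finsetSum' _ fun k _ => (hX j k).enorm]
  exact Finset.sum_le_sum fun k _ => hδ j k

/-! ### Simple integrands in the limit, and the main theorem -/

section FDD

variable {Ω : Set.Ioi (0 : ℝ) → Type*} [∀ ε, MeasurableSpace (Ω ε)] {P : ∀ ε, Measure (Ω ε)}
  [∀ ε, IsProbabilityMeasure (P ε)] {Ω' : Type*} [MeasurableSpace Ω'] {P' : Measure Ω'}
  [IsProbabilityMeasure P'] {T : ℝ}

theorem TendstoFDD.aemeasurable {X : ∀ ε, ℝ → Ω ε → ℝ} {Z : ℝ → Ω' → ℝ}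
    (h : TendstoFDD T X Z P P') (ε : Set.Ioi (0 : ℝ)) {t : ℝ} (ht : t ∈ Set.Icc 0 T) :
    AEMeasurable (X ε t) (P ε) :=
  aemeasurable_pi_iff.1 ((h 1 (fun _ => t) fun _ => ht).forall_aemeasurable ε) 0

/-- Continuous mapping: all the sums are polynomials in the values of the process at the finite set
`S` of endpoints. Treating all `j` and `k` at once gives joint convergence. -/
theorem TendstoFDD.tendstoInDistribution_incrementSum {X : ∀ ε, ℝ → Ω ε → ℝ} {Z : ℝ → Ω' → ℝ}
    (h : TendstoFDD T X Z P P') {r d : ℕ} {n : Fin d → ℕ}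
    (s : Fin r → ∀ k, OffDiagBox (n k) T →₀ ℝ) :
    TendstoInDistribution (fun ε ω j k => incrementSum (s j k) fun t => X ε t ω)
      (comap (Subtype.val : Set.Ioi (0 : ℝ) → ℝ) (𝓝[>] 0))
      (fun ω j k => incrementSum (s j k) fun t => Z t ω) P P' := by
  classical
  let S : Finset ℝ := Finset.univ.biUnion fun j => Finset.univ.biUnion fun k =>
    (s j k).support.biUnion fun Δ => Finset.univ.image Δ.a ∪ Finset.univ.image Δ.b
  have hSa : ∀ j k, ∀ Δ ∈ (s j k).support, ∀ i, Δ.a i ∈ S := fun j k Δ hΔ i => by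
    simp only [S, Finset.mem_biUnion]
    exact ⟨j, Finset.mem_univ _, k, Finset.mem_univ _, Δ, hΔ, by simp⟩
  have hSb : ∀ j k, ∀ Δ ∈ (s j k).support, ∀ i, Δ.b i ∈ S := fun j k Δ hΔ i => by
    simp only [S, Finset.mem_biUnion]
    exact ⟨j, Finset.mem_univ _, k, Finset.mem_univ _, Δ, hΔ, by simp⟩
  have hS : ∀ x ∈ S, x ∈ Set.Icc 0 T := by
    intro x hx
    simp only [S, Finset.mem_biUnion, Finset.mem_union, Finset.mem_image, Finset.mem_univ,
      true_and] at hx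
    obtain ⟨j, k, Δ, -, ⟨i, rfl⟩ | ⟨i, rfl⟩⟩ := hx
    · exact ⟨Δ.zero_le i, (Δ.le i).trans (Δ.le_T i)⟩
    · exact ⟨(Δ.zero_le i).trans (Δ.le i), Δ.le_T i⟩
  -- The default value `0` off `S` is never seen, since every endpoint lies in `S`.
  let ext : (Fin S.card → ℝ) → ℝ → ℝ := fun z t => if ht : t ∈ S then z (S.equivFin ⟨t, ht⟩) else 0
  have hext : ∀ t, Continuous fun z => ext z t := by
    intro t
    by_cases ht : t ∈ S
    · simp only [ext, ht, dif_pos]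
      exact continuous_apply _
    · simp only [ext, ht, dif_neg, not_false_eq_true]
      exact continuous_const
  have hval : ∀ (y : ℝ → ℝ), ∀ t ∈ S, ext (fun p => y (S.equivFin.symm p)) t = y t := by
    intro y t ht
    simp [ext, ht]
  let g : (Fin S.card → ℝ) → Fin r → Fin d → ℝ := fun z j k => incrementSum (s j k) (ext z)
  have hg : Continuous g := by
    refine continuous_pi fun j => continuous_pi fun k => ?_
    simp only [g, incrementSum, Finsupp.sum]
    exact continuous_finsetSum _ fun Δ _ => continuous_const.mul
      (continuous_finsetProd _ fun i _ => (hext _).sub (hext _))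
  have hgval : ∀ y : ℝ → ℝ, g (fun p => y (S.equivFin.symm p)) =
      fun j k => incrementSum (s j k) y := by
    intro y
    funext j k
    exact incrementSum_congr _ fun Δ hΔ i =>
      ⟨hval y _ (hSa j k Δ hΔ i), hval y _ (hSb j k Δ hΔ i)⟩
  have key := (h S.card (fun p => S.equivFin.symm p) fun p =>
    hS _ (S.equivFin.symm p).2).continuous_comp hg
  have e1 : (fun ε => g ∘ fun ω (p : Fin S.card) => X ε (S.equivFin.symm p) ω) =
      fun ε ω j k => incrementSum (s j k) fun t => X ε t ω := by
    funext ε ω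
    exact hgval fun t => X ε t ω
  have e2 : (g ∘ fun ω (p : Fin S.card) => Z (S.equivFin.symm p) ω) =
      fun ω j k => incrementSum (s j k) fun t => Z t ω := by
    funext ω
    exact hgval fun t => Z t ω
  rwa [e1, e2] at key

end FDD

theorem isMultipleWienerIntegral_multipleWienerIntegral {Ω : Type*} [MeasurableSpace Ω]
    {P : Measure Ω} {W : ℝ≥0 → Ω → ℝ} (hW : IsBrownianReal W P) {n : ℕ} {T : ℝ} (hT : 0 < T)
    {f : (Fin n → ℝ) → ℝ} (hf : MemLp f 2 (cubeMeasure n T)) :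
    IsMultipleWienerIntegral W P T f (multipleWienerIntegral W P T f) := by
  have h := hW.exists_isMultipleWienerIntegral hT hf
  rw [multipleWienerIntegral, dif_pos h]
  exact h.choose_spec

theorem theorem2p4
    {Ω : Set.Ioi (0 : ℝ) → Type*} [∀ ε, MeasurableSpace (Ω ε)]
    (P : ∀ ε, Measure (Ω ε)) [∀ ε, IsProbabilityMeasure (P ε)]
    {Ω' : Type*} [MeasurableSpace Ω'] (P' : Measure Ω') [IsProbabilityMeasure P']
    (T : ℝ) (hT : 0 < T)
    -- a standard Brownian motion
    (W : ℝ≥0 → Ω' → ℝ) (hW : IsBrownianReal W P')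
    -- processes with paths in the Cameron-Martin space
    (θ : ∀ ε, ℝ → Ω ε → ℝ)
    (hθ : ∀ ε, ∀ᵐ ω ∂(P ε), MemLp (fun s => θ ε s ω) 2 (volume.restrict (Set.Icc 0 T)))
    (hη : TendstoFDD T (fun ε => etaProcess (θ ε)) (fun t => W t.toNNReal) P P')
    (d : ℕ) (n : Fin d → ℕ) (hn : ∀ k, 1 ≤ n k)
    (f : ∀ k, (Fin (n k) → ℝ) → ℝ) (hf : ∀ k, MemLp (f k) 2 (cubeMeasure (n k) T))
    (hbound : ∀ k, UniformBound P θ T (n k)) :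
    -- the multiple Wiener-Itô integrals in the limit exist
    (∀ k, ∀ t ∈ Set.Icc 0 T, IsMultipleWienerIntegral W P' T ((cube (n k) t).indicator (f k))
      (multipleWienerIntegral W P' T ((cube (n k) t).indicator (f k)))) ∧
    TendstoFDD T
      (fun ε t ω (k : Fin d) => offDiagIntegral (ε : ℝ) (θ ε) (f k) t ω)
      (fun t ω (k : Fin d) =>
        multipleWienerIntegral W P' T ((cube (n k) t).indicator (f k)) ω)
      P P' := by
  have hft : ∀ k t, MemLp ((cube (n k) t).indicator (f k)) 2 (cubeMeasure (n k) T) := fun k t =>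
    (hf k).indicator (measurableSet_cube _ _)
  have hex : ∀ k t, IsMultipleWienerIntegral W P' T ((cube (n k) t).indicator (f k))
      (multipleWienerIntegral W P' T ((cube (n k) t).indicator (f k))) := fun k t =>
    isMultipleWienerIntegral_multipleWienerIntegral hW hT (hft k t)
  refine ⟨fun k t _ => hex k t, fun r t ht => ?_⟩
  choose hmem s hs hI using fun j k => hex k (t j)
  choose C _ hC using hbound
  have hYm : ∀ (g : ∀ k, (Fin (n k) → ℝ) → ℝ) (_ : ∀ k, MemLp (g k) 2 (cubeMeasure (n k) T))
      (ε : Set.Ioi (0 : ℝ)) k,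
      AEMeasurable (offDiagIntegral (ε : ℝ) (θ ε) (g k) T) (P ε) := fun g hg ε k =>
    aemeasurable_offDiagIntegral hT (hθ ε) (fun _ hu => hη.aemeasurable ε hu) (hg k) _
  have hXeq : ∀ (ε : Set.Ioi (0 : ℝ)) j k, offDiagIntegral (ε : ℝ) (θ ε) (f k) (t j) =
      offDiagIntegral (ε : ℝ) (θ ε) ((cube (n k) (t j)).indicator (f k)) T := fun ε j k =>
    funext fun ω => offDiagIntegral_eq_indicator _ _ _ (ht j).2 ω
  have hXm : ∀ (ε : Set.Ioi (0 : ℝ)) j k,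
      AEMeasurable (offDiagIntegral (ε : ℝ) (θ ε) (f k) (t j)) (P ε) := by
    intro ε j k
    rw [hXeq]
    exact hYm (fun k => (cube (n k) (t j)).indicator (f k)) (fun k => hft k (t j)) ε k
  have hlim : ∀ m, TendstoInDistribution
      (fun (ε : Set.Ioi (0 : ℝ)) ω j k => incrementSum (s j k m) fun u => etaProcess (θ ε) u ω)
      (comap (Subtype.val : Set.Ioi (0 : ℝ) → ℝ) (𝓝[>] 0))
      (fun ω j k => simpleIntegral W (s j k m) ω) P P' := fun m =>
    hη.tendstoInDistribution_incrementSum fun j k => s j k m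
  -- `e` bounds the error before the limit, uniformly in `ε`, and `e'` the error in the limit; their
  -- sum is a common bound for both.
  let e : ℕ → Fin r → Fin d → ℝ≥0∞ := fun m j k => ENNReal.ofReal (C k) *
    eLpNorm (fun x => (cube (n k) (t j)).indicator (f k) x - simpleFun (s j k m) x) 2
      (cubeMeasure (n k) T)
  let e' : ℕ → Fin r → Fin d → ℝ≥0∞ := fun m j k =>
    eLpNorm (fun ω => multipleWienerIntegral W P' T ((cube (n k) (t j)).indicator (f k)) ω -
      simpleIntegral W (s j k m) ω) 2 P'
  have he : Tendsto (fun m => ∑ j, ∑ k, (e m j k + e' m j k)) atTop (𝓝 0) := by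
    have h0 : (0 : ℝ≥0∞) = ∑ _j : Fin r, ∑ _k : Fin d, (0 + 0) := by simp
    rw [h0]
    refine tendsto_finsetSum _ fun j _ => tendsto_finsetSum _ fun k _ =>
      Tendsto.add ?_ (hI j k)
    simpa using ENNReal.Tendsto.const_mul (a := ENNReal.ofReal (C k)) (hs j k)
      (Or.inr ENNReal.ofReal_ne_top)
  refine tendstoInDistribution_of_approx
    (fun ε => aemeasurable_pi_iff.2 fun j => aemeasurable_pi_iff.2 fun k => hXm ε j k)
    (aemeasurable_pi_iff.2 fun j => aemeasurable_pi_iff.2 fun k =>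
      (hmem j k).1.aemeasurable) hlim (fun m => ?_) (fun m => ?_) he
  · have hev : ∀ᶠ ε in 𝓝[>] (0 : ℝ), ∀ j k, ∀ {Ω : Type _} (θ : ℝ → Ω → ℝ) (ω : Ω),
        MemLp (fun u => θ u ω) 2 (volume.restrict (Set.Icc 0 T)) →
        offDiagIntegral ε θ (simpleFun (s j k m)) T ω =
          incrementSum (s j k m) fun t => etaProcess θ t ω :=
      eventually_all.2 fun j => eventually_all.2 fun k =>
        eventually_offDiagIntegral_simpleFun (s j k m)
    filter_upwards [preimage_mem_comap hev] with ε hε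
    refine (lintegral_enorm_pi_pi_le (fun j k => ?_) (fun j k => ?_)).trans
      (Finset.sum_le_sum fun j _ => Finset.sum_le_sum fun k _ => le_self_add)
    · exact (hXm ε j k).sub (aemeasurable_pi_iff.1 (aemeasurable_pi_iff.1
        ((hlim m).forall_aemeasurable ε) j) k)
    -- The uniform bound is applied at time `T` to the truncated integrand minus its simple
    -- approximation.
    · refine le_trans (le_of_eq (lintegral_congr_ae ?_)) (hC k _ ((hft k (t j)).sub
        (memLp_simpleFun (s j k m) 2)) ε T ⟨hT.le, le_rfl⟩)
      filter_upwards [hθ ε] with ω hω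
      change ‖offDiagIntegral (ε : ℝ) (θ ε) (f k) (t j) ω -
        incrementSum (s j k m) (fun u => etaProcess (θ ε) u ω)‖ₑ = _
      rw [hXeq, ← hε j k (θ ε) ω hω]
      congr 1
      exact (offDiagIntegral_sub hω (hft k (t j)) (memLp_simpleFun _ 2) _).symm
  · refine (lintegral_enorm_pi_pi_le (fun j k => ?_) (fun j k => ?_)).trans
      (Finset.sum_le_sum fun j _ => Finset.sum_le_sum fun k _ => le_add_self)
    · exact (hmem j k).1.aemeasurable.sub (hW.memLp_simpleIntegral _).1.aemeasurable
    -- On a probability space the `L¹` norm is at most the `L²` norm.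
    · have h1 := eLpNorm_le_eLpNorm_of_exponent_le (μ := P') (p := 1) (q := 2) (by norm_num)
        ((hmem j k).1.sub (hW.memLp_simpleIntegral (s j k m)).1)
      rwa [eLpNorm_one_eq_lintegral_enorm] at h1
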